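/- **Setting.** All algebras are unital algebras over $\mathbb C$; repeated indices in a finite set $\mathcal I$ are summed. A representation of a bialgebra $\mathcal A$ is a square matrix $v$ over $\mathcal A$ with $\Delta v_{ij}=v_{ik}\otimes v_{kj}$ and $\epsilon(v_{ij})=\delta_{ij}$; $(v\otimes w)_{ij,kl}=v_{ik}w_{jl}$; $I$ denotes the unit and also the trivial one-dimensional representation; $\mathrm{Mor}(v,w)$ is the space of complex matrices $M$ with $Mv=wM$. For $a\in\mathcal A$ and a linear functional $\rho$ on $\mathcal A$ put $a*\rho=(\rho\otimes\mathrm{id})\Delta a$ and $\rho*a=(\mathrm{id}\otimes\rho)\Delta a$. Let $\mathcal A=\mathrm{Poly}(H)$ be a Hopf $*$-algebra all of whose representations are completely reducible, and let $\Lambda=(\Lambda_{ij})_{i,j\in\mathcal I}$ be an irreducible representation of $\mathcal A$ with $\Lambda_{ij}^*=\Lambda_{ij}$, such that $\mathrm{Mor}(v\otimes w,\Lambda\otimes v\otimes w)=\{0\}$ for all irreducible representations $v,w$ of $\mathcal A$. Let $\mathcal B=\mathrm{Poly}(G)$ be a $*$-bialgebra which contains $\mathcal A$ as a sub-$*$-bialgebra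 and is generated as an algebra by $\mathcal A$ and elements $p_i=p_i^*$ $(i\in\mathcal I)$, not all in $\mathcal A$, such that $\begin{pmatrix}\Lambda&p\\0&I\end{pmatrix}$ is a representation of $\mathcal B$ and $\Gamma\mathcal A\subset\Gamma$ for $\Gamma=\mathcal A\cdot\mathrm{span}\{p_i\}+\mathcal A$. Let $G$ be described by linear functionals $f_{st},\eta_s$ on $\mathcal A$ and numbers $T_{ij}\in\mathbb C$ $(s,t,i,j\in\mathcal I)$, that is, with $R_{ij,sm}=f_{im}(\Lambda_{js})$ and $Z_{ij,s}=\eta_i(\Lambda_{js})$, assume that $R^2=\mathbf 1$ and that in $\mathcal B$ $$p_sa=(a*f_{st})p_t+a*\eta_s-\Lambda_{st}(\eta_t*a)\qquad(a\in\mathcal A),$$ $$(R-\mathbf 1)_{kl,ij}\bigl(p_ip_j-Z_{ij,s}p_s+T_{ij}-\Lambda_{im}\Lambda_{jn}T_{mn}\bigr)=0 .$$ A pair $(\mathcal C,\Psi)$ is an *analogue of Minkowski space associated with $G$* if there are $x_i\in\mathcal C$ $(i\in\mathcal I)$ such that 1. $\mathcal C$ is a unital $*$-algebra generated by the $x_i$,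 and $\Psi:\mathcal C\to\mathcal B\otimes\mathcal C$ is a unital $*$-homomorphism with $(\epsilon\otimes\mathrm{id})\Psi=\mathrm{id}$, $(\mathrm{id}\otimes\Psi)\Psi=(\Delta\otimes\mathrm{id})\Psi$, $x_i^*=x_i$ and $\Psi x_i=\Lambda_{ij}\otimes x_j+p_i\otimes I$; 2. if $\Psi W\subset\mathcal A\otimes W$ for a linear subspace $W\subset\mathcal C$, then $W\subset\mathbb C I$; 3. if $(\mathcal C',\Psi')$ also satisfies 1 and 2 for some $x_i'\in\mathcal C'$, then there is a unital $*$-homomorphism $\rho:\mathcal C\to\mathcal C'$ with $\rho(x_i)=x_i'$ and $(\mathrm{id}\otimes\rho)\Psi=\Psi'\rho$. **Theorem.** Assume that $$\mathrm{Mor}(I,\Lambda\otimes\Lambda)\cap\ker(R+\mathbf 1)=\{0\}\quad\text{and}\quad \mathrm{Mor}(I,\Lambda\otimes\Lambda\otimes\Lambda)=\{0\}.$$ Let $\mathcal C_0$ be the universal unital algebra generated by $x_i$ $(i\in\mathcal I)$ with the relations $$(R-\mathbf 1)_{kl,ij}\bigl(x_ix_j-Z_{ij,m}x_m+T_{ij}\bigr)=0\qquad(k,l\in\mathcal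 I).$$ Then $\mathcal C_0$ has a $*$-algebra structure with $x_i^*=x_i$ and a unital $*$-homomorphism $\Psi_0:\mathcal C_0\to\mathcal B\otimes\mathcal C_0$ with $\Psi_0x_i=\Lambda_{ij}\otimes x_j+p_i\otimes I$. The pair $(\mathcal C_0,\Psi_0)$ is an analogue of Minkowski space associated with $G$, and a pair $(\mathcal C,\Psi)$, where $\mathcal C$ is a unital $*$-algebra and $\Psi:\mathcal C\to\mathcal B\otimes\mathcal C$ a unital $*$-homomorphism, is an analogue of Minkowski space associated with $G$ if and only if there is a $*$-isomorphism $e:\mathcal C\to\mathcal C_0$ with $(\mathrm{id}\otimes e)\Psi=\Psi_0e$. So $G$ has exactly one analogue of Minkowski space up to $*$-isomorphism. -/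

import Mathlib

open scoped TensorProduct Kronecker

universe u w

namespace InhomQG

/-! ## Representations (matrix corepresentations) and intertwiners -/

section Representations

variable {A : Type*} [Ring A] [Bialgebra ℂ A]

/-- `v` is a representation of the quantum group described by `A`:
`Δ v_ij = ∑ k, v_ik ⊗ v_kj` and `ε (v_ij) = δ_ij`. -/
structure IsRep {n : Type*} [Fintype n] [DecidableEq n] (v : Matrix n n A) : Prop where
  comul : ∀ i j, Coalgebra.comul (R := ℂ) (v i j) = ∑ k, v i k ⊗ₜ[ℂ] v k j
  counit : ∀ i j, Coalgebra.counit (R := ℂ) (v i j) = if i = j then 1 else 0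

/-- `M ∈ Mor(v, w)`, that is `M v = w M`, for a complex matrix `M`. -/
def IsMor {n m : Type*} [Fintype n] [Fintype m]
    (v : Matrix n n A) (w : Matrix m m A) (M : Matrix m n ℂ) : Prop :=
  M.map (algebraMap ℂ A) * v = w * M.map (algebraMap ℂ A)

/-- The trivial one-dimensional representation `I`. -/
def trivialRep (A : Type*) [Ring A] : Matrix Unit Unit A := 1

/-- `W` is an invariant subspace of the carrier space of `v`, that is, a subcomodule for the
coaction `e_j ↦ ∑ i, e_i ⊗ v_ij`. -/
def IsInvariant {n : Type*} [Fintype n] (v : Matrix n n A) (W : Submodule ℂ (n → ℂ)) : Prop :=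
  ∀ φ : A →ₗ[ℂ] ℂ, ∀ x ∈ W, (v.map φ).mulVec x ∈ W

/-- An irreducible representation. -/
structure IsIrrep {n : Type*} [Fintype n] [DecidableEq n] (v : Matrix n n A) : Prop where
  isRep : IsRep v
  nonempty : Nonempty n
  eq_bot_or_eq_top : ∀ W : Submodule ℂ (n → ℂ), IsInvariant v W → W = ⊥ ∨ W = ⊤

/-- Complete reducibility: each invariant subspace has an invariant complement. -/
def IsCompletelyReducible {n : Type*} [Fintype n] (v : Matrix n n A) : Prop :=
  ∀ W : Submodule ℂ (n → ℂ), IsInvariant v W →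
    ∃ W' : Submodule ℂ (n → ℂ), IsInvariant v W' ∧ IsCompl W W'

/-- `a * ρ = (ρ ⊗ id) Δ a`. -/
noncomputable def convLeft (a : A) (ρ : A →ₗ[ℂ] ℂ) : A :=
  TensorProduct.lid ℂ A (ρ.rTensor A (Coalgebra.comul (R := ℂ) a))

/-- `ρ * a = (id ⊗ ρ) Δ a`. -/
noncomputable def convRight (ρ : A →ₗ[ℂ] ℂ) (a : A) : A :=
  TensorProduct.rid ℂ A (ρ.lTensor A (Coalgebra.comul (R := ℂ) a))

end Representations

/-! ## The homogeneous part `H` and the inhomogeneous quantum group `G` -/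

/-- The comultiplication is a `*`-homomorphism. For a bialgebra (Hopf algebra) over `ℂ` with
a conjugate linear, antimultiplicative involution, this is what makes it a `*`-bialgebra
(Hopf `*`-algebra). -/
def IsStarBialgebra (A : Type*) [Ring A] [Bialgebra ℂ A] [StarRing A] [StarModule ℂ A] : Prop :=
  ∀ a : A, Coalgebra.comul (R := ℂ) (star a) = star (Coalgebra.comul (R := ℂ) a)

/-- The standing assumptions on the Hopf `*`-algebra `A = Poly(H)` and on the distinguished
representation `Λ` of `H`. -/
structure IsHomogeneousPart {I A : Type*} [Fintype I] [DecidableEq I] [Ring A] [HopfAlgebra ℂ A]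
    [StarRing A] [StarModule ℂ A] (Λ : Matrix I I A) : Prop where
  star_bialgebra : IsStarBialgebra A
  /-- each representation of `H` is completely reducible -/
  completely_reducible : ∀ (n : ℕ) (v : Matrix (Fin n) (Fin n) A),
    IsRep v → IsCompletelyReducible v
  /-- `Λ` is an irreducible representation of `H` -/
  irreducible : IsIrrep Λ
  /-- `Mor(v ⊗ w, Λ ⊗ v ⊗ w) = 0` for irreducible `v`, `w` -/
  mor_eq_zero : ∀ (n m : ℕ) (v : Matrix (Fin n) (Fin n) A) (w : Matrix (Fin m) (Fin m) A),
    IsIrrep v → IsIrrep w → ∀ M : Matrix (I × Fin n × Fin m) (Fin n × Fin m) ℂ,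
      IsMor (v ⊗ₖ w) (Λ ⊗ₖ (v ⊗ₖ w)) M → M = 0
  /-- `Λ` coincides with its conjugate -/
  star_Λ : ∀ i j, star (Λ i j) = Λ i j

/-- The matrix `R_{ij,sm} = f_im (Λ_js)`. -/
def matR {I A : Type*} [Ring A] [Bialgebra ℂ A] (Λ : Matrix I I A) (f : I → I → A →ₗ[ℂ] ℂ) :
    Matrix (I × I) (I × I) ℂ :=
  fun ij sm => f ij.1 sm.2 (Λ ij.2 sm.1)

/-- The matrix `Z_{ij,s} = η_i (Λ_js)`. -/
def matZ {I A : Type*} [Ring A] [Bialgebra ℂ A] (Λ : Matrix I I A) (η : I → A →ₗ[ℂ] ℂ) :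
    Matrix (I × I) I ℂ :=
  fun ij s => η ij.1 (Λ ij.2 s)

/-- The defining conditions of a bialgebra `B = Poly(G)` built from `A = Poly(H)` (embedded in `B`
by `inc`) and from the translations `p`. -/
structure IsInhomogeneous {I A B : Type*} [Fintype I] [DecidableEq I] [Ring A] [HopfAlgebra ℂ A]
    [Ring B] [Bialgebra ℂ B] (Λ : Matrix I I A) (inc : A →ₐc[ℂ] B) (p : I → B) : Prop where
  /-- `B` is generated by `A` and the `p_s` -/
  generated : Algebra.adjoin ℂ (Set.range inc ∪ Set.range p) = ⊤
  /-- `A` is a sub-bialgebra of `B` -/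
  inc_injective : Function.Injective inc
  /-- the block matrix `(Λ, p; 0, I)` is a representation of `G` -/
  isRep : IsRep (Matrix.fromBlocks (Λ.map inc) (Matrix.of fun (i : I) (_ : Unit) => p i) 0 1)
  /-- not all `p_i` lie in `A` -/
  exists_notMem : ∃ i, p i ∉ Set.range inc
  /-- `Γ A ⊆ Γ`, where `Γ = A · span {p_i} + A` -/
  bimodule : ∀ (i : I) (a : A), ∃ (b : I → A) (c : A), p i * inc a = ∑ t, inc (b t) * p t + inc c

/-- `f`, `η`, `T` are the functionals and numbers that describe the commutation relations of `B`,
with `R² = 1` and with as many quadratic relations among the `p_i` as possible (the rows of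
`R - 1` span the space of all `x` with `x (R + 1) = 0`). -/
structure IsDescribedBy {I A B : Type*} [Fintype I] [DecidableEq I] [Ring A] [HopfAlgebra ℂ A]
    [Ring B] [Bialgebra ℂ B] (Λ : Matrix I I A) (inc : A →ₐc[ℂ] B) (p : I → B)
    (f : I → I → A →ₗ[ℂ] ℂ) (η : I → A →ₗ[ℂ] ℂ) (T : I × I → ℂ) : Prop where
  /-- `p_s a = (a * f_st) p_t + a * η_s - Λ_st (η_t * a)` -/
  commutation : ∀ (s : I) (a : A),
    p s * inc a = ∑ t, inc (convLeft a (f s t)) * p t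
      + inc (convLeft a (η s) - ∑ t, Λ s t * convRight (η t) a)
  R_sq : matR Λ f * matR Λ f = 1
  /-- `(R - 1)_{kl,ij} (p_i p_j - η_i(Λ_js) p_s + T_ij - Λ_im Λ_jn T_mn) = 0` -/
  quadratic : ∀ kl : I × I, ∑ ij : I × I, (matR Λ f - 1) kl ij •
    (p ij.1 * p ij.2 - ∑ s, matZ Λ η ij s • p s + algebraMap ℂ B (T ij)
      - inc (∑ mn : I × I, T mn • (Λ ij.1 mn.1 * Λ ij.2 mn.2))) = 0

/-- The `*`-structure of `B`: a `*`-bialgebra, with the given `*` on `A`, and `p_i* = p_i`. -/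
structure IsStarCompatible {I A B : Type*} [Ring A] [HopfAlgebra ℂ A] [StarRing A]
    [StarModule ℂ A] [Ring B] [Bialgebra ℂ B] [StarRing B] [StarModule ℂ B]
    (inc : A →ₐc[ℂ] B) (p : I → B) : Prop where
  star_bialgebra : IsStarBialgebra B
  inc_star : ∀ a, inc (star a) = star (inc a)
  star_p : ∀ i, star (p i) = p i

/-! ## Analogues of Minkowski space -/

/-- Axioms 1 and 2 of an analogue of Minkowski space, for the generators `x`. -/
structure IsMinkowskiPre {I A B : Type*} [Fintype I] [Ring A] [HopfAlgebra ℂ A]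
    [Ring B] [Bialgebra ℂ B] [StarRing B] [StarModule ℂ B]
    (Λ : Matrix I I A) (inc : A →ₐc[ℂ] B) (p : I → B)
    {C : Type*} [Ring C] [Algebra ℂ C] [StarRing C] [StarModule ℂ C]
    (Ψ : C →⋆ₐ[ℂ] B ⊗[ℂ] C) (x : I → C) : Prop where
  generated : Algebra.adjoin ℂ (Set.range x) = ⊤
  /-- `(ε ⊗ id) Ψ = id` -/
  counit : ∀ c, TensorProduct.lid ℂ C ((Coalgebra.counit (R := ℂ) (A := B)).rTensor C (Ψ c)) = c
  /-- `(id ⊗ Ψ) Ψ = (Δ ⊗ id) Ψ` -/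
  coassoc : ∀ c, Ψ.toAlgHom.toLinearMap.lTensor B (Ψ c) =
    TensorProduct.assoc ℂ B B C ((Coalgebra.comul (R := ℂ) (A := B)).rTensor C (Ψ c))
  star_x : ∀ i, star (x i) = x i
  /-- `Ψ x_i = Λ_ij ⊗ x_j + p_i ⊗ I` -/
  coaction : ∀ i, Ψ (x i) = ∑ j, inc (Λ i j) ⊗ₜ[ℂ] x j + p i ⊗ₜ[ℂ] (1 : C)
  /-- if `Ψ W ⊆ A ⊗ W` for a linear subspace `W` of `C`, then `W ⊆ ℂ I` -/
  eq_scalar : ∀ W : Submodule ℂ C,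
    (∀ y ∈ W, Ψ y ∈ LinearMap.range
      (TensorProduct.map (inc : A →ₐ[ℂ] B).toLinearMap W.subtype)) →
    W ≤ Submodule.span ℂ {1}

/-- `(C, Ψ)` is an analogue of Minkowski space associated with `G`: axioms 1, 2 and the
universality axiom 3. -/
def IsMinkowski {I A B : Type*} [Fintype I] [Ring A] [HopfAlgebra ℂ A]
    [Ring B] [Bialgebra ℂ B] [StarRing B] [StarModule ℂ B]
    (Λ : Matrix I I A) (inc : A →ₐc[ℂ] B) (p : I → B)
    {C : Type w} [Ring C] [Algebra ℂ C] [StarRing C] [StarModule ℂ C]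
    (Ψ : C →⋆ₐ[ℂ] B ⊗[ℂ] C) : Prop :=
  ∃ x : I → C, IsMinkowskiPre Λ inc p Ψ x ∧
    ∀ (C' : Type w) [Ring C'] [Algebra ℂ C'] [StarRing C'] [StarModule ℂ C']
      (Ψ' : C' →⋆ₐ[ℂ] B ⊗[ℂ] C') (x' : I → C'), IsMinkowskiPre Λ inc p Ψ' x' →
      ∃ ρ : C →⋆ₐ[ℂ] C', (∀ i, ρ (x i) = x' i) ∧
        ∀ c, ρ.toAlgHom.toLinearMap.lTensor B (Ψ c) = Ψ' (ρ c)

/-- The relators `(R - 1)_{kl,ij} (x_i x_j - Z_{ij,m} x_m + T_ij)` in the free algebra. -/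
noncomputable def minkowskiRelator {I : Type u} [Fintype I] [DecidableEq I]
    (R : Matrix (I × I) (I × I) ℂ) (Z : Matrix (I × I) I ℂ) (T : I × I → ℂ) (kl : I × I) :
    FreeAlgebra ℂ I :=
  ∑ ij : I × I, (R - 1) kl ij •
    (FreeAlgebra.ι ℂ ij.1 * FreeAlgebra.ι ℂ ij.2 - ∑ m, Z ij m • FreeAlgebra.ι ℂ m
      + algebraMap ℂ (FreeAlgebra ℂ I) (T ij))

/-- The universal unital algebra generated by `x_i` (`i ∈ I`) with the relations
`(R - 1)(x ⊗ x - Z x + T) = 0`. -/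
abbrev MinkowskiAlgebra {I : Type u} [Fintype I] [DecidableEq I]
    (R : Matrix (I × I) (I × I) ℂ) (Z : Matrix (I × I) I ℂ) (T : I × I → ℂ) : Type u :=
  RingQuot fun a b : FreeAlgebra ℂ I => (∃ kl, a = minkowskiRelator R Z T kl) ∧ b = 0

/-- The generators `x_i` of the universal algebra. -/
noncomputable def MinkowskiAlgebra.x {I : Type u} [Fintype I] [DecidableEq I]
    (R : Matrix (I × I) (I × I) ℂ) (Z : Matrix (I × I) I ℂ) (T : I × I → ℂ) (i : I) :
    MinkowskiAlgebra R Z T :=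
  RingQuot.mkAlgHom ℂ _ (FreeAlgebra.ι ℂ i)

end InhomQG

open InhomQG

/-! Two facts carry the theorem.

The first concerns the relators w = (R - 1)(x ⊗ x - Zx + T). Under x ↦ Λ ⊗ x + p ⊗ 1 the mixed terms
assemble to (R + 1)W, which R - 1 kills because R² = 1. The pure p-terms are the quadratic relations
of B, and R - 1 intertwines Λ ⊗ Λ. So w transforms by Λ ⊗ Λ alone (`relator_coaction`), and the
coaction descends to C₀. Conversely, if axioms 1 and 2 hold in some algebra, the span of w coacts
with coefficients in A, hence consists of scalars. These scalars form an invariant vector of Λ ⊗ Λ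
in the image of R - 1, so in the kernel of R + 1, and they vanish by the first Mor hypothesis
(`IsMinkowskiPre.relator_eq_zero`). Thus C₀ maps onto every candidate, which gives universality and
uniqueness.

The second fact is that the quadratic relations imply axiom 2 (`mem_span_one_of_coaction_mem`).
Modulo lower degree in the left leg, Ψ of a homogeneous word in the x is the same word in the p,
tensored with 1. It suffices that a word whose p-value drops in degree also has an x-value of lower
degree (`snd_mem_of_fst_mem`). For this, the part of Δ linear in the right leg defines a twisted
derivative d of words. It lowers the length by one, preserves the drop of degree in B, and satisfies
Euler's formula ∑ x_a d_a(u) = n u modulo lower degree. Induction on n and division by n finish the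
argument. Pairs in B × C carry both values of one formal word at once.

The `*`-structure of C₀ requires that conjugation preserve the relations. Applying the involution of
B to the relations of B and comparing coefficients gives reality conditions for R, for Z (through
Mor(Λ, Λ ⊗ Λ) = 0) and for (R - 1)T (through the first Mor hypothesis again). -/

namespace InhomQG

/-! ### Commutation of p with Λ, independence of the p_i modulo A, and the intertwiner R. -/

section Structure

variable {I A B : Type*} [Fintype I] [DecidableEq I] [Ring A] [HopfAlgebra ℂ A]
  [Ring B] [Bialgebra ℂ B] {Λ : Matrix I I A} {inc : A →ₐc[ℂ] B} {p : I → B}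
  {f : I → I → A →ₗ[ℂ] ℂ} {η : I → A →ₗ[ℂ] ℂ} {T : I × I → ℂ}

theorem comul_inc (inc : A →ₐc[ℂ] B) (a : A) : Coalgebra.comul (R := ℂ) (inc a) =
    TensorProduct.map (inc : A →ₐ[ℂ] B).toLinearMap (inc : A →ₐ[ℂ] B).toLinearMap
      (Coalgebra.comul (R := ℂ) a) :=
  (CoalgHomClass.map_comp_comul_apply inc a).symm

theorem IsRep.comul_inc {n : Type*} [Fintype n] [DecidableEq n] {v : Matrix n n A} (hv : IsRep v)
    (inc : A →ₐc[ℂ] B) (i j : n) :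
    Coalgebra.comul (R := ℂ) (inc (v i j)) = ∑ k, inc (v i k) ⊗ₜ[ℂ] inc (v k j) := by
  rw [InhomQG.comul_inc, hv.comul, map_sum]
  rfl

theorem IsInhomogeneous.comul_p (hG : IsInhomogeneous Λ inc p) (i : I) :
    Coalgebra.comul (R := ℂ) (p i) = ∑ j, inc (Λ i j) ⊗ₜ[ℂ] p j + p i ⊗ₜ[ℂ] (1 : B) := by
  simpa [Fintype.sum_sum_type] using hG.isRep.comul (Sum.inl i) (Sum.inr ())

theorem IsInhomogeneous.counit_p (hG : IsInhomogeneous Λ inc p) (i : I) :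
    Coalgebra.counit (R := ℂ) (p i) = 0 := by
  simpa using hG.isRep.counit (Sum.inl i) (Sum.inr ())

theorem convLeft_eq {n : Type*} [Fintype n] [DecidableEq n] {v : Matrix n n A} (hv : IsRep v)
    (ρ : A →ₗ[ℂ] ℂ) (i j : n) : convLeft (v i j) ρ = ∑ k, ρ (v i k) • v k j := by
  simp [convLeft, hv.comul]

theorem convRight_eq {n : Type*} [Fintype n] [DecidableEq n] {v : Matrix n n A} (hv : IsRep v)
    (ρ : A →ₗ[ℂ] ℂ) (i j : n) : convRight ρ (v i j) = ∑ k, ρ (v k j) • v i k := by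
  simp [convRight, hv.comul]

theorem IsRep.mul_antipode {n : Type*} [Fintype n] [DecidableEq n] {v : Matrix n n A}
    (hv : IsRep v) (i j : n) :
    ∑ k, v i k * HopfAlgebra.antipode ℂ (v k j) = if i = j then 1 else 0 := by
  have h := HopfAlgebra.mul_antipode_lTensor_comul_apply (R := ℂ) (v i j)
  rw [hv.comul, hv.counit, map_sum, map_sum] at h
  simp only [LinearMap.lTensor_tmul, LinearMap.mul'_apply] at h
  rw [h]
  split_ifs <;> simp

/-- For a matrix with self-adjoint entries the adjoint of the antipode gives a left inverse of the
transpose. -/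
theorem IsRep.star_antipode_mul [StarRing A] {n : Type*} [Fintype n] [DecidableEq n]
    {v : Matrix n n A} (hv : IsRep v) (hs : ∀ i j, star (v i j) = v i j) (i j : n) :
    ∑ k, star (HopfAlgebra.antipode ℂ (v k j)) * v i k = if i = j then 1 else 0 := by
  have h := congrArg star (hv.mul_antipode i j)
  rw [star_sum] at h
  simp only [star_mul, hs] at h
  rw [h]
  split_ifs <;> simp

/-- The inhomogeneous term of the commutation relations of `p` and `Λ`. -/
noncomputable def inhomTerm (Λ : Matrix I I A) (η : I → A →ₗ[ℂ] ℂ) (ij : I × I) (n : I) : A :=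
  ∑ s, matZ Λ η ij s • Λ s n - ∑ ts : I × I, matZ Λ η ts n • (Λ ij.1 ts.1 * Λ ij.2 ts.2)

/-- The commutation rule at a = Λ_jn: the values of f on entries of Λ are the entries of R, and the
two terms with η make up `inhomTerm`. This is the rule that brings words into the normal order with
A on the left. -/
theorem IsDescribedBy.p_mul_inc (hd : IsDescribedBy Λ inc p f η T) (hΛ : IsRep Λ) (i j n : I) :
    p i * inc (Λ j n) = ∑ st : I × I, matR Λ f (i, j) st • (inc (Λ st.1 n) * p st.2)
      + inc (inhomTerm Λ η (i, j) n) := by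
  rw [hd.commutation, inhomTerm]
  refine congrArg₂ (· + ·) ?_ (congrArg inc (congrArg₂ (· - ·) ?_ ?_))
  · rw [Fintype.sum_prod_type_right]
    refine Finset.sum_congr rfl fun t _ => ?_
    rw [convLeft_eq hΛ, map_sum, Finset.sum_mul]
    exact Finset.sum_congr rfl fun s _ => by rw [map_smul, smul_mul_assoc]; rfl
  · rw [convLeft_eq hΛ]
    rfl
  · rw [Fintype.sum_prod_type]
    refine Finset.sum_congr rfl fun t _ => ?_
    rw [convRight_eq hΛ, Finset.mul_sum]
    exact Finset.sum_congr rfl fun s _ => by rw [mul_smul_comm]; rfl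

/-- The map `x ⊗ y ↦ φ x • g y`. -/
noncomputable def slice {X Y E : Type*} [AddCommGroup X] [Module ℂ X] [AddCommGroup Y] [Module ℂ Y]
    [AddCommGroup E] [Module ℂ E] (φ : X →ₗ[ℂ] ℂ) (g : Y →ₗ[ℂ] E) : X ⊗[ℂ] Y →ₗ[ℂ] E :=
  (TensorProduct.lid ℂ E).toLinearMap ∘ₗ TensorProduct.map φ g

@[simp]
theorem slice_tmul {X Y E : Type*} [AddCommGroup X] [Module ℂ X] [AddCommGroup Y] [Module ℂ Y]
    [AddCommGroup E] [Module ℂ E] (φ : X →ₗ[ℂ] ℂ) (g : Y →ₗ[ℂ] E) (x : X) (y : Y) :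
    slice φ g (x ⊗ₜ y) = φ x • g y := by
  simp [slice]

/-- The image of `A` in `B` as a linear subspace. -/
def incRange (inc : A →ₐc[ℂ] B) : Submodule ℂ B := LinearMap.range (inc : A →ₐ[ℂ] B).toLinearMap

theorem mem_incRange {inc : A →ₐc[ℂ] B} {b : B} : b ∈ incRange inc ↔ ∃ a, inc a = b := Iff.rfl

theorem inc_mem_incRange (inc : A →ₐc[ℂ] B) (a : A) : inc a ∈ incRange inc := ⟨a, rfl⟩

theorem slice_comul_inc (inc : A →ₐc[ℂ] B) (φ : B →ₗ[ℂ] ℂ) (a : A) :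
    slice φ (incRange inc).mkQ (Coalgebra.comul (R := ℂ) (inc a)) = 0 := by
  rw [comul_inc]
  induction Coalgebra.comul (R := ℂ) a with
  | zero => simp
  | add x y hx hy => simp [hx, hy]
  | tmul x y =>
    have : (incRange inc).mkQ (inc y) = 0 := by simp [inc_mem_incRange]
    simp [this]

theorem IsInhomogeneous.slice_comul_p (hG : IsInhomogeneous Λ inc p) (φ : B →ₗ[ℂ] ℂ) (i : I) :
    slice φ (incRange inc).mkQ (Coalgebra.comul (R := ℂ) (p i)) =
      (incRange inc).mkQ (∑ j, φ (inc (Λ i j)) • p j) := by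
  have : (incRange inc).mkQ 1 = 0 := by
    simpa using inc_mem_incRange inc 1
  rw [hG.comul_p]
  simp [this]

theorem exists_functional_comp_inc (hinc : Function.Injective inc) (φ : A →ₗ[ℂ] ℂ) :
    ∃ φ' : B →ₗ[ℂ] ℂ, ∀ a, φ' (inc a) = φ a := by
  obtain ⟨g, hg⟩ := LinearMap.exists_leftInverse_of_injective (inc : A →ₐ[ℂ] B).toLinearMap
    (LinearMap.ker_eq_bot.mpr hinc)
  exact ⟨φ ∘ₗ g, fun a => congrArg φ (LinearMap.congr_fun hg a)⟩

/-- The `p i` are linearly independent modulo `A`. -/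
theorem IsInhomogeneous.eq_zero_of_sum_mem (hG : IsInhomogeneous Λ inc p) (hΛ : IsIrrep Λ)
    (c : I → ℂ) (hc : ∑ i, c i • p i ∈ incRange inc) : c = 0 := by
  -- The relations among the p_i modulo A are stable under row multiplication by φ(Λ): apply φ to
  -- the left leg of Δ(∑ c_i p_i) and reduce the right leg modulo A.
  have inv : ∀ c : I → ℂ, ∑ i, c i • p i ∈ incRange inc → ∀ φ : A →ₗ[ℂ] ℂ,
      ∑ j, Matrix.vecMul c (Λ.map φ) j • p j ∈ incRange inc := by
    rintro c ⟨a, ha⟩ φ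
    obtain ⟨φ', hφ'⟩ := exists_functional_comp_inc hG.inc_injective φ
    have h := slice_comul_inc inc φ' a
    change inc a = _ at ha
    rw [ha] at h
    simp only [map_sum, map_smul, hG.slice_comul_p] at h
    rw [← (incRange inc).ker_mkQ, LinearMap.mem_ker]
    rw [← h]
    simp only [hφ', map_sum, map_smul, Matrix.vecMul, dotProduct, Matrix.map_apply, Finset.sum_smul,
      Finset.smul_sum, smul_smul]
    exact Finset.sum_comm
  -- The relations are stable as row vectors, whereas irreducibility of Λ speaks of column vectors;
  -- hence the passage to the annihilator.
  let U : Submodule ℂ (I → ℂ) :=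
    { carrier := {x | ∀ c : I → ℂ, ∑ i, c i • p i ∈ incRange inc → c ⬝ᵥ x = 0}
      add_mem' := fun {x y} hx hy c hc => by rw [dotProduct_add, hx c hc, hy c hc, add_zero]
      zero_mem' := fun c _ => dotProduct_zero c
      smul_mem' := fun r x hx c hc => by rw [dotProduct_smul, hx c hc, smul_zero] }
  have hU : IsInvariant Λ U := fun φ x hx c hc => by
    rw [Matrix.dotProduct_mulVec]
    exact hx _ (inv c hc φ)
  rcases hΛ.eq_bot_or_eq_top U hU with h | h
  · exfalso
    obtain ⟨i, hi⟩ := hG.exists_notMem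
    -- A zero annihilator would force every p_i into A. The chosen i with p_i outside A yields a
    -- functional that kills all relations but not the i-th basis vector, a nonzero element of U.
    let V : Submodule ℂ (I → ℂ) := (incRange inc).comap (Fintype.linearCombination ℂ p)
    have hV : Pi.single i 1 ∉ V := fun h => hi (by
      simpa [V, Fintype.linearCombination_apply_single, mem_incRange] using h)
    obtain ⟨g, hg, hgV⟩ := V.exists_le_ker_of_notMem hV
    have hx : (fun j => g (Pi.single j 1)) ∈ U := fun c hc => by
      have : g c = 0 := hgV hc
      rw [← this, LinearMap.pi_apply_eq_sum_univ g c]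
      refine Finset.sum_congr rfl fun i _ => congrArg (fun y => c i * g y) ?_
      ext j
      simp [Pi.single_apply, eq_comm]
    rw [h] at hx
    exact hg (congrFun ((Submodule.mem_bot ℂ).mp hx) i)
  · funext i
    have : Pi.single i 1 ∈ U := h ▸ Submodule.mem_top
    simpa using this c hc

/-- Independence modulo A makes c ↦ ∑ c_i p_i injective into B/A, and the coordinates of a left
inverse are the functionals. Applied to the right leg of a coproduct they read off the coefficient
of p_m and ignore A. -/
theorem IsInhomogeneous.exists_dual (hG : IsInhomogeneous Λ inc p) (hΛ : IsIrrep Λ) :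
    ∃ χ : I → B →ₗ[ℂ] ℂ, (∀ m a, χ m (inc a) = 0) ∧
      ∀ m k, χ m (p k) = if k = m then 1 else 0 := by
  obtain ⟨g, hg⟩ := LinearMap.exists_leftInverse_of_injective
    ((incRange inc).mkQ ∘ₗ Fintype.linearCombination ℂ p) (by
      rw [LinearMap.ker_eq_bot']
      intro c hc
      refine hG.eq_zero_of_sum_mem hΛ c ?_
      rwa [LinearMap.comp_apply, ← LinearMap.mem_ker, Submodule.ker_mkQ] at hc)
  refine ⟨fun m => LinearMap.proj m ∘ₗ g ∘ₗ (incRange inc).mkQ, fun m a => ?_, fun m k => ?_⟩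
  · have : (incRange inc).mkQ (inc a) = 0 := by simp [inc_mem_incRange]
    simp only [LinearMap.comp_apply, this, map_zero]
  · have := congrFun (LinearMap.congr_fun hg (Pi.single k 1)) m
    simp only [LinearMap.comp_apply, Fintype.linearCombination_apply_single, one_smul,
      LinearMap.id_apply, Pi.single_apply] at this
    simp only [LinearMap.comp_apply, LinearMap.proj_apply, this, eq_comm]

theorem inc_mul_mem_incRange {inc : A →ₐc[ℂ] B} (a : A) {b : B} (hb : b ∈ incRange inc) :
    inc a * b ∈ incRange inc := by
  obtain ⟨c, rfl⟩ := hb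
  exact ⟨a * c, map_mul inc a c⟩

theorem slice_mul_inc (hinc : IsRep Λ) (φ : B →ₗ[ℂ] ℂ) (x y : B) (j n : I) :
    slice φ (incRange inc).mkQ ((x ⊗ₜ[ℂ] y) * Coalgebra.comul (R := ℂ) (inc (Λ j n))) =
      ∑ m, φ (x * inc (Λ j m)) • (incRange inc).mkQ (y * inc (Λ m n)) := by
  simp [hinc.comul_inc, Finset.mul_sum]

theorem slice_inc_mul (hinc : IsRep Λ) (φ : B →ₗ[ℂ] ℂ) (x y : B) (j n : I) :
    slice φ (incRange inc).mkQ (Coalgebra.comul (R := ℂ) (inc (Λ j n)) * (x ⊗ₜ[ℂ] y)) =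
      ∑ m, φ (inc (Λ j m) * x) • (incRange inc).mkQ (inc (Λ m n) * y) := by
  simp [hinc.comul_inc, Finset.sum_mul]

theorem IsDescribedBy.mkQ_p_mul_inc (hd : IsDescribedBy Λ inc p f η T) (hΛ : IsRep Λ)
    (i j n : I) : (incRange inc).mkQ (p i * inc (Λ j n)) =
      ∑ st : I × I, matR Λ f (i, j) st • (incRange inc).mkQ (inc (Λ st.1 n) * p st.2) := by
  have : ∀ a, (incRange inc).mkQ (inc a) = 0 := fun a => by simp [inc_mem_incRange]
  rw [hd.p_mul_inc hΛ, map_add, this, add_zero, map_sum]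
  simp only [map_smul]

/-- The elements `Λ_sn p_t` are linearly independent modulo `A`, jointly in `n`. -/
theorem IsInhomogeneous.eq_zero_of_sum_mul_mem [StarRing A] (hG : IsInhomogeneous Λ inc p)
    (hΛ : IsIrrep Λ) (hs : ∀ i j, star (Λ i j) = Λ i j) (c : I × I → ℂ)
    (hc : ∀ n, ∑ st : I × I, c st • (inc (Λ st.1 n) * p st.2) ∈ incRange inc) : c = 0 := by
  -- Multiplying the n-th relation on the left by S(Λ_nr)* and summing over n cancels Λ_sn and
  -- selects s = r. The ordinary antipode would stand in the wrong order; its adjoint acts as the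
  -- inverse antipode on the self-adjoint entries.
  have key : ∀ r, ∑ t, c (r, t) • p t ∈ incRange inc := by
    intro r
    have h : ∑ n, inc (star (HopfAlgebra.antipode ℂ (Λ n r))) *
        ∑ st : I × I, c st • (inc (Λ st.1 n) * p st.2) ∈ incRange inc :=
      Submodule.sum_mem _ fun n _ => inc_mul_mem_incRange _ (hc n)
    convert h using 1
    simp only [Finset.mul_sum, mul_smul_comm, ← mul_assoc, ← map_mul]
    rw [Finset.sum_comm]
    simp only [← Finset.smul_sum, ← Finset.sum_mul, ← map_sum inc, hΛ.isRep.star_antipode_mul hs]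
    simp [Fintype.sum_prod_type, apply_ite inc, ite_mul, smul_ite, Finset.sum_ite_irrel]
  funext st
  exact congrFun (hG.eq_zero_of_sum_mem hΛ _ (key st.1)) st.2

/-- `R` intertwines `Λ ⊗ Λ` with itself. -/
theorem IsInhomogeneous.matR_intertwines [StarRing A] (hG : IsInhomogeneous Λ inc p)
    (hd : IsDescribedBy Λ inc p f η T) (hΛ : IsIrrep Λ) (hs : ∀ i j, star (Λ i j) = Λ i j)
    (ij st : I × I) :
    ∑ kl : I × I, matR Λ f ij kl • (Λ kl.1 st.1 * Λ kl.2 st.2) =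
      ∑ kl : I × I, matR Λ f kl st • (Λ ij.1 kl.1 * Λ ij.2 kl.2) := by
  obtain ⟨i, j⟩ := ij
  rw [← sub_eq_zero, ← Module.forall_dual_apply_eq_zero_iff ℂ]
  intro φ
  set D : I × I → A := fun st => ∑ kl : I × I, matR Λ f (i, j) kl • (Λ kl.1 st.1 * Λ kl.2 st.2) -
      ∑ kl : I × I, matR Λ f kl st • (Λ i kl.1 * Λ j kl.2) with hD
  obtain ⟨φ', hφ'⟩ := exists_functional_comp_inc hG.inc_injective φ
  -- Apply (φ' ⊗ mod A)Δ to the rule for p_i Λ_jn. On one side p_k Λ_mn has to be reordered, which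
  -- puts R to the right of Λ ⊗ Λ; on the other side R already stands to the left.
  have key : ∀ n, ∑ st : I × I, φ (D st) • (incRange inc).mkQ (inc (Λ st.1 n) * p st.2) = 0 := by
    intro n
    have h := congrArg (fun b => slice φ' (incRange inc).mkQ (Coalgebra.comul (R := ℂ) b))
      (hd.p_mul_inc hΛ.isRep i j n)
    simp only [map_add, map_sum, map_smul, Bialgebra.comul_mul, slice_comul_inc, add_zero,
      hG.comul_p, add_mul, mul_add, Finset.sum_mul, Finset.mul_sum] at h
    have h0 : ∀ a : A, (incRange inc).mkQ (inc a) = 0 := fun a => by simp [inc_mem_incRange]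
    simp only [slice_mul_inc hΛ.isRep, slice_inc_mul hΛ.isRep, one_mul, mul_one, h0, smul_zero,
      Finset.sum_const_zero, add_zero, hd.mkQ_p_mul_inc hΛ.isRep, ← map_mul, hφ'] at h
    have h1 : ∑ st : I × I, (∑ kl : I × I, matR Λ f kl st * φ (Λ i kl.1 * Λ j kl.2)) •
        (incRange inc).mkQ (inc (Λ st.1 n) * p st.2) =
        ∑ st : I × I, (∑ kl : I × I, matR Λ f (i, j) kl * φ (Λ kl.1 st.1 * Λ kl.2 st.2)) •
        (incRange inc).mkQ (inc (Λ st.1 n) * p st.2) := by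
      refine Eq.trans ?_ (h.trans ?_)
      · simp only [Finset.sum_smul, Finset.smul_sum, smul_smul]
        rw [Finset.sum_comm, Fintype.sum_prod_type]
        simp only [mul_comm]
      · simp only [Finset.sum_smul, Finset.smul_sum, smul_smul]
        conv_rhs => rw [Finset.sum_comm]
        exact Finset.sum_congr rfl fun kl _ => by rw [Fintype.sum_prod_type_right]
    simp only [hD, map_sub, map_sum, map_smul, smul_eq_mul, sub_smul, Finset.sum_sub_distrib]
    rw [h1, sub_self]
  refine congrFun (hG.eq_zero_of_sum_mul_mem hΛ hs (fun st => φ (D st)) fun n => ?_) st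
  rw [← (incRange inc).ker_mkQ, LinearMap.mem_ker]
  simpa only [map_sum, map_smul] using key n

end Structure
-- Filtrations by degree and subspaces of tensor products.
section Filtration

variable {D E : Type*} [Ring D] [Algebra ℂ D] [Ring E] [Algebra ℂ E]

/-- The filtration `0, S, Γ S, Γ Γ S, …`. -/
def filt (S Γ : Submodule ℂ D) : ℕ → Submodule ℂ D
  | 0 => ⊥
  | 1 => S
  | n + 2 => Γ * filt S Γ (n + 1)

theorem mul_filt_le (S Γ : Submodule ℂ D) (n : ℕ) : Γ * filt S Γ n ≤ filt S Γ (n + 1) := by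
  cases n with
  | zero => simp [filt]
  | succ n => exact le_rfl

theorem mul_filt_pred_le (S Γ : Submodule ℂ D) (n : ℕ) : Γ * filt S Γ (n - 1) ≤ filt S Γ n := by
  cases n with
  | zero => simp [filt]
  | succ n => exact mul_filt_le S Γ n

theorem filt_le_succ {S Γ : Submodule ℂ D} (h : (1 : D) ∈ Γ) (n : ℕ) :
    filt S Γ n ≤ filt S Γ (n + 1) := fun x hx => by
  simpa using mul_filt_le S Γ n (Submodule.mul_mem_mul h hx)

theorem filt_mono {S Γ : Submodule ℂ D} (h : (1 : D) ∈ Γ) : Monotone (filt S Γ) :=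
  monotone_nat_of_le_succ (filt_le_succ h)

theorem left_mul_filt_le {S Γ : Submodule ℂ D} (hS : S * S ≤ S) (hΓ : S * Γ ≤ Γ) (n : ℕ) :
    S * filt S Γ n ≤ filt S Γ n := by
  match n with
  | 0 => simp [filt]
  | 1 => exact hS
  | n + 2 =>
    rw [filt, ← mul_assoc]
    exact mul_le_mul_left hΓ _

theorem map_filt_le (g : D →ₐ[ℂ] E) {S Γ : Submodule ℂ D} {S' Γ' : Submodule ℂ E}
    (hS : S.map g.toLinearMap ≤ S') (hΓ : Γ.map g.toLinearMap ≤ Γ') (n : ℕ) :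
    (filt S Γ n).map g.toLinearMap ≤ filt S' Γ' n := by
  match n with
  | 0 => simp [filt]
  | 1 => exact hS
  | n + 2 =>
    rw [filt, filt, Submodule.map_mul]
    exact mul_le_mul' hΓ (map_filt_le g hS hΓ (n + 1))

/-- Induction along the filtration by words in the `y i`. -/
theorem filt_span_range_induction {I : Type*} {y : I → D} {n : ℕ} {Q : D → Prop} (zero : Q 0)
    (add : ∀ a b, Q a → Q b → Q (a + b))
    (mul : ∀ i, ∀ v ∈ filt 1 (Submodule.span ℂ (Set.range y)) (n + 1), Q (y i * v))
    {u : D} (hu : u ∈ filt 1 (Submodule.span ℂ (Set.range y)) (n + 2)) : Q u := by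
  rw [filt] at hu
  refine Submodule.mul_induction_on hu (fun a ha => ?_) add
  induction ha using Submodule.span_induction with
  | mem a ha =>
    obtain ⟨i, rfl⟩ := ha
    exact mul i
  | zero => simpa using fun _ _ => zero
  | add a b _ _ ha hb => exact fun v hv => add_mul a b v ▸ add _ _ (ha v hv) (hb v hv)
  | smul c a _ ha =>
    intro v hv
    rw [smul_mul_assoc, ← mul_smul_comm]
    exact ha _ (Submodule.smul_mem _ c hv)

/-- The subspace of `D ⊗ E` spanned by `u ⊗ v` with `u ∈ U` and `v ∈ V`. -/
def tens (U : Submodule ℂ D) (V : Submodule ℂ E) : Submodule ℂ (D ⊗[ℂ] E) :=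
  Submodule.map₂ (TensorProduct.mk ℂ D E) U V

theorem tmul_mem_tens {U : Submodule ℂ D} {V : Submodule ℂ E} {a : D} {b : E} (ha : a ∈ U)
    (hb : b ∈ V) : a ⊗ₜ[ℂ] b ∈ tens U V :=
  Submodule.apply_mem_map₂ _ ha hb

theorem tens_mono {U U' : Submodule ℂ D} {V V' : Submodule ℂ E} (hU : U ≤ U') (hV : V ≤ V') :
    tens U V ≤ tens U' V' :=
  Submodule.map₂_le_map₂ hU hV

theorem tens_mul_tens_le (U U' : Submodule ℂ D) (V V' : Submodule ℂ E) :
    tens U V * tens U' V' ≤ tens (U * U') (V * V') := by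
  simp only [tens, Submodule.map₂_eq_span_image2]
  rw [Submodule.span_mul_span, Submodule.span_le]
  rintro _ ⟨_, ⟨a, ha, b, hb, rfl⟩, _, ⟨a', ha', b', hb', rfl⟩, rfl⟩
  refine Submodule.subset_span ⟨a * a', Submodule.mul_mem_mul ha ha', b * b',
    Submodule.mul_mem_mul hb hb', ?_⟩
  simp

theorem mul_mem_tens {U U' U'' : Submodule ℂ D} {V V' V'' : Submodule ℂ E} (hU : U * U' ≤ U'')
    (hV : V * V' ≤ V'') {s t : D ⊗[ℂ] E} (hs : s ∈ tens U V) (ht : t ∈ tens U' V') :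
    s * t ∈ tens U'' V'' :=
  tens_mono hU hV (tens_mul_tens_le _ _ _ _ (Submodule.mul_mem_mul hs ht))

/-- The map `x ⊗ y ↦ φ y • x`. -/
noncomputable def sliceRight (φ : E →ₗ[ℂ] ℂ) : D ⊗[ℂ] E →ₗ[ℂ] D :=
  (TensorProduct.rid ℂ D).toLinearMap ∘ₗ φ.lTensor D

@[simp]
theorem sliceRight_tmul (φ : E →ₗ[ℂ] ℂ) (a : D) (b : E) :
    sliceRight φ (a ⊗ₜ[ℂ] b) = φ b • a := by
  simp [sliceRight]

theorem sliceRight_mem {U : Submodule ℂ D} {V : Submodule ℂ E} (φ : E →ₗ[ℂ] ℂ) {t : D ⊗[ℂ] E}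
    (ht : t ∈ tens U V) : sliceRight φ t ∈ U := by
  suffices tens U V ≤ U.comap (sliceRight φ) from this ht
  refine Submodule.map₂_le.2 fun a ha b _ => ?_
  simpa using U.smul_mem _ ha

theorem sliceRight_eq_zero {U : Submodule ℂ D} {V : Submodule ℂ E} {φ : E →ₗ[ℂ] ℂ}
    (hφ : ∀ b ∈ V, φ b = 0) {t : D ⊗[ℂ] E} (ht : t ∈ tens U V) : sliceRight φ t = 0 := by
  suffices tens U V ≤ LinearMap.ker (sliceRight φ) from this ht
  refine Submodule.map₂_le.2 fun a ha b hb => ?_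
  simp [hφ b hb]

end Filtration

/-! ### The degree filtration of B and its behaviour under Δ. -/

section Degree

variable {I A B : Type*} [Ring A] [HopfAlgebra ℂ A]
  [Ring B] [Bialgebra ℂ B]

/-- The bimodule `Γ = A · span {p_i} + A`. -/
def gam (inc : A →ₐc[ℂ] B) (p : I → B) : Submodule ℂ B :=
  incRange inc * Submodule.span ℂ (insert 1 (Set.range p))

/-- The elements of `B` of degree less than `n`. -/
abbrev filtB (inc : A →ₐc[ℂ] B) (p : I → B) (n : ℕ) : Submodule ℂ B :=
  filt (incRange inc) (gam inc p) n

theorem incRange_mul_self (inc : A →ₐc[ℂ] B) : incRange inc * incRange inc ≤ incRange inc := by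
  refine Submodule.mul_le.2 fun a ha b hb => ?_
  obtain ⟨a, rfl⟩ := ha
  exact inc_mul_mem_incRange a hb

theorem one_mem_incRange (inc : A →ₐc[ℂ] B) : (1 : B) ∈ incRange inc := ⟨1, map_one inc⟩

theorem incRange_le_gam (inc : A →ₐc[ℂ] B) (p : I → B) : incRange inc ≤ gam inc p := fun a ha => by
  simpa [gam] using Submodule.mul_mem_mul ha (Submodule.subset_span (R := ℂ)
    (Set.mem_insert (1 : B) (Set.range p)))

theorem one_mem_gam (inc : A →ₐc[ℂ] B) (p : I → B) : (1 : B) ∈ gam inc p :=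
  incRange_le_gam inc p (one_mem_incRange inc)

theorem p_mem_gam (inc : A →ₐc[ℂ] B) (p : I → B) (i : I) : p i ∈ gam inc p := by
  simpa [gam] using Submodule.mul_mem_mul (one_mem_incRange inc) (Submodule.subset_span (R := ℂ)
    (Set.mem_insert_of_mem (1 : B) (Set.mem_range_self (f := p) i)))

theorem incRange_mul_gam (inc : A →ₐc[ℂ] B) (p : I → B) :
    incRange inc * gam inc p ≤ gam inc p := by
  rw [gam, ← mul_assoc]
  exact mul_le_mul_left (incRange_mul_self inc) _

theorem incRange_mul_filtB (inc : A →ₐc[ℂ] B) (p : I → B) (n : ℕ) :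
    incRange inc * filtB inc p n ≤ filtB inc p n :=
  left_mul_filt_le (incRange_mul_self inc) (incRange_mul_gam inc p) n

theorem filtB_mono (inc : A →ₐc[ℂ] B) (p : I → B) : Monotone (filtB inc p) :=
  filt_mono (one_mem_gam inc p)

theorem incRange_le_filtB (inc : A →ₐc[ℂ] B) (p : I → B) (n : ℕ) :
    incRange inc ≤ filtB inc p (n + 1) :=
  filtB_mono inc p (Nat.le_add_left 1 n)

theorem comul_mem_tens_incRange (inc : A →ₐc[ℂ] B) {b : B} (hb : b ∈ incRange inc) :
    Coalgebra.comul (R := ℂ) b ∈ tens (incRange inc) (incRange inc) := by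
  obtain ⟨a, rfl⟩ := hb
  change Coalgebra.comul (R := ℂ) (inc a) ∈ _
  rw [comul_inc]
  induction Coalgebra.comul (R := ℂ) a with
  | zero => simp
  | add x y hx hy => rw [map_add]; exact add_mem hx hy
  | tmul x y => exact tmul_mem_tens (inc_mem_incRange inc x) (inc_mem_incRange inc y)

variable [Fintype I] [DecidableEq I] {Λ : Matrix I I A} {inc : A →ₐc[ℂ] B} {p : I → B}

/-- In Δp_i = p_i ⊗ 1 + ∑ Λ_ij ⊗ p_j the letter p goes to just one leg, and the other leg stays in
A. -/
theorem IsInhomogeneous.comul_gam (hG : IsInhomogeneous Λ inc p) {b : B} (hb : b ∈ gam inc p) :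
    Coalgebra.comul (R := ℂ) b ∈ tens (gam inc p) (incRange inc) ⊔ tens (incRange inc) ⊤ := by
  refine Submodule.mul_induction_on hb (fun a ha c hc => ?_) fun x y hx hy => by
    rw [map_add]; exact add_mem hx hy
  have ha' := comul_mem_tens_incRange inc ha
  rw [Bialgebra.comul_mul]
  induction hc using Submodule.span_induction with
  | mem c hc =>
    rcases hc with rfl | ⟨i, rfl⟩
    · rw [Bialgebra.comul_one, mul_one]
      exact Submodule.mem_sup_left (tens_mono (incRange_le_gam inc p) le_rfl ha')
    · rw [hG.comul_p, mul_add, add_comm, Finset.mul_sum]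
      refine Submodule.add_mem_sup (mul_mem_tens (incRange_mul_gam inc p) (incRange_mul_self inc)
        ha' (tmul_mem_tens (p_mem_gam inc p i) (one_mem_incRange inc)))
        (Submodule.sum_mem _ fun j _ => mul_mem_tens (incRange_mul_self inc) le_top
        ha' (tmul_mem_tens (inc_mem_incRange inc _) Submodule.mem_top))
  | zero => simp
  | add x y _ _ hx hy => rw [map_add, mul_add]; exact add_mem hx hy
  | smul r x _ hx => rw [map_smul, mul_smul_comm]; exact Submodule.smul_mem _ r hx

/-- In the coproduct of a product of at most n elements of `gam`, either every p goes to the left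
leg, and the right leg lies in A, or some p goes right, and the left leg has degree less than n. -/
theorem IsInhomogeneous.comul_filtB (hG : IsInhomogeneous Λ inc p) (n : ℕ) {b : B}
    (hb : b ∈ filtB inc p (n + 1)) : Coalgebra.comul (R := ℂ) b ∈
      tens (filtB inc p n) ⊤ ⊔ tens (filtB inc p (n + 1)) (incRange inc) := by
  induction n generalizing b with
  | zero => exact Submodule.mem_sup_right (comul_mem_tens_incRange inc hb)
  | succ n ih =>
    refine Submodule.mul_induction_on hb (fun a ha c hc => ?_) fun x y hx hy => by
      rw [map_add]; exact add_mem hx hy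
    rw [Bialgebra.comul_mul]
    obtain ⟨a₁, ha₁, a₂, ha₂, ha⟩ := Submodule.mem_sup.1 (hG.comul_gam ha)
    obtain ⟨c₁, hc₁, c₂, hc₂, hc⟩ := Submodule.mem_sup.1 (ih hc)
    rw [← ha, ← hc, add_mul, mul_add, mul_add]
    refine add_mem (Submodule.add_mem_sup ?_ ?_) (Submodule.mem_sup_left (add_mem ?_ ?_))
    · exact mul_mem_tens (mul_filt_le _ _ n) le_top ha₁ hc₁
    · exact mul_mem_tens (mul_filt_le _ _ (n + 1)) (incRange_mul_self inc) ha₁ hc₂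
    · exact mul_mem_tens ((incRange_mul_filtB inc p n).trans (filtB_mono inc p n.le_succ)) le_top
        ha₂ hc₁
    · exact mul_mem_tens (incRange_mul_filtB inc p (n + 1)) le_top ha₂ hc₂

omit [DecidableEq I] in
/-- The leading coefficient of a word in elements that transform like the `x i`. -/
theorem coaction_sub_mem {Y D : Type*} [Ring Y] [Algebra ℂ Y] [Ring D] [Algebra ℂ D]
    (P : Y →ₐ[ℂ] B) (Θ : Y →ₐ[ℂ] B ⊗[ℂ] D) (y : I → Y) (z : I → D) (hP : ∀ i, P (y i) = p i)
    (hΘ : ∀ i, Θ (y i) = ∑ j, inc (Λ i j) ⊗ₜ[ℂ] z j + p i ⊗ₜ[ℂ] (1 : D)) (n : ℕ) {u : Y}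
    (hu : u ∈ filt 1 (Submodule.span ℂ (Set.range y)) (n + 1)) :
    P u ∈ filtB inc p (n + 1) ∧ Θ u - P u ⊗ₜ[ℂ] (1 : D) ∈ tens (filtB inc p n) ⊤ := by
  induction n generalizing u with
  | zero =>
    obtain ⟨c, rfl⟩ := Submodule.mem_one.1 hu
    rw [AlgHom.commutes, AlgHom.commutes, Algebra.algebraMap_eq_smul_one,
      Algebra.algebraMap_eq_smul_one, Algebra.TensorProduct.one_def, TensorProduct.smul_tmul',
      sub_self]
    exact ⟨Submodule.smul_mem _ _ (one_mem_incRange inc), zero_mem _⟩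
  | succ n ih =>
    refine filt_span_range_induction (Q := fun u => P u ∈ filtB inc p (n + 1 + 1) ∧
      Θ u - P u ⊗ₜ[ℂ] (1 : D) ∈ tens (filtB inc p (n + 1)) ⊤) ?_ (fun a b ha hb => ?_) (fun i v hv => ?_) hu
    · simp
    · rw [map_add, map_add, TensorProduct.add_tmul, add_sub_add_comm]
      exact ⟨add_mem ha.1 hb.1, add_mem ha.2 hb.2⟩
    · obtain ⟨h₁, h₂⟩ := ih hv
      have hp := p_mem_gam inc p i
      rw [map_mul, map_mul, hP]
      refine ⟨mul_filt_le _ _ (n + 1) (Submodule.mul_mem_mul hp h₁), ?_⟩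
      -- With Θ v = P v ⊗ 1 + e, the product (p_i ⊗ 1)(P v ⊗ 1) is the new leading term. The terms
      -- with Λ_ij do not raise the left degree, and (p_i ⊗ 1)e stays one degree below.
      set e := Θ v - P v ⊗ₜ[ℂ] (1 : D) with he
      rw [← sub_add_cancel (Θ v) (P v ⊗ₜ[ℂ] (1 : D)), ← he, hΘ, add_mul, mul_add (p i ⊗ₜ[ℂ] (1 : D)),
        Algebra.TensorProduct.tmul_mul_tmul, one_mul, ← add_assoc, add_sub_cancel_right,
        Finset.sum_mul]
      refine add_mem (Submodule.sum_mem _ fun j _ => ?_) ?_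
      · refine mul_mem_tens (incRange_mul_filtB inc p (n + 1)) le_top
          (tmul_mem_tens (inc_mem_incRange inc _) Submodule.mem_top) (add_mem (tens_mono
            (filtB_mono inc p n.le_succ) le_rfl h₂) (tmul_mem_tens h₁ Submodule.mem_top))
      · exact mul_mem_tens (mul_filt_le _ _ n) le_top (tmul_mem_tens hp Submodule.mem_top) h₂

end Degree
-- Leading terms: the twisted derivative, Euler's formula, and axiom 2 from the relations.
section LeadingTerm

variable {I A B C : Type*} [Fintype I] [DecidableEq I] [Ring A] [HopfAlgebra ℂ A]
  [Ring B] [Bialgebra ℂ B] [Ring C] [Algebra ℂ C]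
  {Λ : Matrix I I A} {inc : A →ₐc[ℂ] B} {p : I → B}
  {f : I → I → A →ₗ[ℂ] ℂ} {η : I → A →ₗ[ℂ] ℂ} {T : I × I → ℂ} {x : I → C}

/-- The elements of degree less than `n` of an algebra generated by the `x i`. -/
abbrev filtX (x : I → C) (n : ℕ) : Submodule ℂ C :=
  filt 1 (Submodule.span ℂ (insert 1 (Set.range x))) n

/-- The homogeneous words of length `n - 1` in the pairs `(p i, x i)`. -/
abbrev words (p : I → B) (x : I → C) (n : ℕ) : Submodule ℂ (B × C) :=
  filt 1 (Submodule.span ℂ (Set.range fun i => (p i, x i))) n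

omit [Fintype I] [DecidableEq I] in
theorem pair_mul_mem_words (i : I) {n : ℕ} {v : B × C} (hv : v ∈ words p x n) :
    (p i, x i) * v ∈ words p x (n + 1) :=
  mul_filt_le _ _ n (Submodule.mul_mem_mul (Submodule.subset_span ⟨i, rfl⟩) hv)

omit [Fintype I] [DecidableEq I] in
theorem fst_mem_filtB (n : ℕ) {u : B × C} (hu : u ∈ words p x n) : u.1 ∈ filtB inc p n := by
  refine map_filt_le (AlgHom.fst ℂ B C) ?_ ?_ n ⟨u, hu, rfl⟩
  · rintro _ ⟨_, ⟨c, rfl⟩, rfl⟩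
    simpa using Submodule.smul_mem _ c (one_mem_incRange inc)
  · rw [Submodule.map_span, Submodule.span_le]
    rintro _ ⟨_, ⟨i, rfl⟩, rfl⟩
    exact p_mem_gam inc p i

omit [Fintype I] [DecidableEq I] in
theorem snd_mem_filtX (n : ℕ) {u : B × C} (hu : u ∈ words p x n) : u.2 ∈ filtX x n := by
  refine map_filt_le (AlgHom.snd ℂ B C) ?_ ?_ n ⟨u, hu, rfl⟩
  · rintro _ ⟨_, ⟨c, rfl⟩, rfl⟩
    exact ⟨c, rfl⟩
  · rw [Submodule.map_span, Submodule.span_le]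
    rintro _ ⟨_, ⟨i, rfl⟩, rfl⟩
    exact Submodule.subset_span (Set.mem_insert_of_mem _ ⟨i, rfl⟩)

omit [Fintype I] [DecidableEq I] in
theorem x_mul_mem_filtX (i : I) {n : ℕ} {c : C} (hc : c ∈ filtX x n) :
    x i * c ∈ filtX x (n + 1) :=
  mul_filt_le _ _ n (Submodule.mul_mem_mul
    (Submodule.subset_span (Set.mem_insert_of_mem _ ⟨i, rfl⟩)) hc)

omit [Fintype I] [DecidableEq I] in
theorem filtX_le_succ (x : I → C) (n : ℕ) : filtX x n ≤ filtX x (n + 1) :=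
  filt_le_succ (Submodule.subset_span (Set.mem_insert _ _)) n

/-- A twisted derivation `d` of words: it describes the part of the comultiplication which is
linear in the second leg, and satisfies an Euler formula. -/
theorem exists_twisted_derivative (hG : IsInhomogeneous Λ inc p)
    (hd : IsDescribedBy Λ inc p f η T) (hΛ : IsRep Λ)
    (hx : ∀ kl : I × I, ∑ ij : I × I, (matR Λ f - 1) kl ij • (x ij.1 * x ij.2) ∈
      Submodule.span ℂ (insert 1 (Set.range x))) (n : ℕ) {u : B × C}
    (hu : u ∈ words p x (n + 1)) :
    ∃ d : I → B × C, (∀ a, d a ∈ words p x n) ∧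
      (Coalgebra.comul (R := ℂ) u.1 - ∑ m, ∑ a, (inc (Λ a m) * (d a).1) ⊗ₜ[ℂ] p m ∈
        tens (filtB inc p (n - 1)) ⊤ ⊔ tens (filtB inc p (n + 1)) (incRange inc)) ∧
      ∑ a, x a * (d a).2 - (n : ℂ) • u.2 ∈ filtX x n := by
  induction n generalizing u with
  | zero =>
    -- A word of length 0 is a scalar. Both `words p x 0` and `filtB inc p (0 - 1)` are zero, so d
    -- has to vanish.
    refine ⟨0, fun a => zero_mem _, ?_, by simp⟩
    simpa using hG.comul_filtB 0 (fst_mem_filtB (inc := inc) 1 hu)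
  | succ n ih =>
    refine filt_span_range_induction (Q := fun u => ∃ d : I → B × C, (∀ a, d a ∈ words p x (n + 1)) ∧
      (Coalgebra.comul (R := ℂ) u.1 - ∑ m, ∑ a, (inc (Λ a m) * (d a).1) ⊗ₜ[ℂ] p m ∈
        tens (filtB inc p n) ⊤ ⊔ tens (filtB inc p (n + 2)) (incRange inc)) ∧
      ∑ a, x a * (d a).2 - ((n + 1 : ℕ) : ℂ) • u.2 ∈ filtX x (n + 1)) ?_ ?_ ?_ hu
    · exact ⟨0, fun a => zero_mem _, by simp, by simp⟩
    · rintro u v ⟨d, h₁, h₂, h₃⟩ ⟨d', h₁', h₂', h₃'⟩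
      refine ⟨d + d', fun a => add_mem (h₁ a) (h₁' a), ?_, ?_⟩
      · convert add_mem h₂ h₂' using 1
        simp only [Pi.add_apply, Prod.fst_add, map_add, mul_add, TensorProduct.add_tmul,
          Finset.sum_add_distrib]
        abel
      · convert add_mem h₃ h₃' using 1
        simp only [Pi.add_apply, Prod.snd_add, smul_add, mul_add, Finset.sum_add_distrib]
        abel
    · intro i v hv
      obtain ⟨d, h₁, h₂, h₃⟩ := ih hv
      -- The twisted Leibniz rule: either the first letter is removed, or it moves past the Λ_sm in
      -- front of d_s(v), which costs a factor R.
      refine ⟨fun a => (if a = i then v else 0) + ∑ s, ∑ b, matR Λ f (i, s) (a, b) •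
        ((p b, x b) * d s), fun a => ?_, ?_, ?_⟩
      · refine add_mem ?_ (Submodule.sum_mem _ fun s _ => Submodule.sum_mem _ fun b _ =>
          Submodule.smul_mem _ _ (pair_mul_mem_words b (h₁ s)))
        split_ifs
        exacts [hv, zero_mem _]
      · have hp := p_mem_gam inc p i
        have hv' := (coaction_sub_mem (AlgHom.fst ℂ B C)
          ((Bialgebra.comulAlgHom ℂ B).comp (AlgHom.fst ℂ B C)) (fun i => (p i, x i)) p
          (fun _ => rfl) (Λ := Λ) (inc := inc) hG.comul_p n hv).2
        simp only [AlgHom.comp_apply, AlgHom.fst_apply, Bialgebra.comulAlgHom_apply] at hv'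
        set e₁ := Coalgebra.comul (R := ℂ) v.1 - v.1 ⊗ₜ[ℂ] (1 : B) with he₁
        set e₂ := Coalgebra.comul (R := ℂ) v.1 - ∑ m, ∑ a, (inc (Λ a m) * (d a).1) ⊗ₜ[ℂ] p m
          with he₂
        have key : Coalgebra.comul (R := ℂ) (p i * v.1) -
            ∑ m, ∑ a, (inc (Λ a m) * ((if a = i then v else 0) + ∑ s, ∑ b,
              matR Λ f (i, s) (a, b) • ((p b, x b) * d s)).1) ⊗ₜ[ℂ] p m =
            ∑ m, (inc (Λ i m) ⊗ₜ[ℂ] p m) * e₁ +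
            ∑ m, ∑ s, (inc (inhomTerm Λ η (i, s) m) * (d s).1) ⊗ₜ[ℂ] p m +
            (p i ⊗ₜ[ℂ] (1 : B)) * e₂ := by
          -- Moving p_i past Λ_sm produces the R-term of the new derivative. The remaining A-term
          -- has a left leg of lower degree.
          have h₄ : ∀ m, ∑ s, p i * (inc (Λ s m) * (d s).1) =
              ∑ a, inc (Λ a m) * (∑ s, ∑ b, matR Λ f (i, s) (a, b) • (p b * (d s).1)) +
              ∑ s, inc (inhomTerm Λ η (i, s) m) * (d s).1 := by
            intro m
            simp only [← mul_assoc, hd.p_mul_inc hΛ, add_mul, Finset.sum_add_distrib]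
            congr 1
            simp only [Finset.mul_sum, Finset.sum_mul, Fintype.sum_prod_type, smul_mul_assoc,
              mul_smul_comm, mul_assoc]
            exact Finset.sum_comm
          have h₅ : (p i ⊗ₜ[ℂ] (1 : B)) * ∑ m, ∑ a, (inc (Λ a m) * (d a).1) ⊗ₜ[ℂ] p m =
              ∑ m, (∑ s, p i * (inc (Λ s m) * (d s).1)) ⊗ₜ[ℂ] p m := by
            simp only [Finset.mul_sum, TensorProduct.sum_tmul, Algebra.TensorProduct.tmul_mul_tmul,
              one_mul]
          rw [he₁, he₂, mul_sub (p i ⊗ₜ[ℂ] (1 : B)), h₅, Bialgebra.comul_mul, hG.comul_p, add_mul,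
            Finset.sum_mul]
          simp only [h₄, mul_sub, Prod.fst_add, Prod.fst_sum, Prod.smul_fst, Prod.fst_mul, mul_add,
            TensorProduct.add_tmul, Finset.sum_add_distrib, Finset.sum_sub_distrib,
            Algebra.TensorProduct.tmul_mul_tmul, mul_one, apply_ite Prod.fst, Prod.fst_zero,
            mul_ite, mul_zero, TensorProduct.sum_tmul, TensorProduct.ite_tmul, Finset.sum_ite_eq',
            Finset.mem_univ, if_true]
          abel
        rw [Prod.fst_mul]
        refine key ▸ add_mem (Submodule.mem_sup_left (add_mem (Submodule.sum_mem _ fun m _ => ?_)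
          (Submodule.sum_mem _ fun m _ => Submodule.sum_mem _ fun s _ => ?_))) ?_
        · exact mul_mem_tens (incRange_mul_filtB inc p n) le_top
            (tmul_mem_tens (inc_mem_incRange inc _) Submodule.mem_top) hv'
        · exact tmul_mem_tens (incRange_mul_filtB inc p n (Submodule.mul_mem_mul
            (inc_mem_incRange inc _) (fst_mem_filtB n (h₁ s)))) Submodule.mem_top
        · obtain ⟨e, he, e', he', hee⟩ := Submodule.mem_sup.1 h₂
          rw [← hee, mul_add]
          refine Submodule.add_mem_sup ?_ ?_
          · exact mul_mem_tens (mul_filt_pred_le _ _ n) le_top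
              (tmul_mem_tens hp Submodule.mem_top) he
          · exact mul_mem_tens (mul_filt_le _ _ (n + 1)) (incRange_mul_self inc)
              (tmul_mem_tens hp (one_mem_incRange inc)) he'
      -- Replacing R by 1 in the new derivative gives x_i ∑ x_s d_s(v), that is n x_i v up to lower
      -- degree, and the removed letter contributes one more x_i v. The error contains (R - 1)(x ⊗
      -- x), of degree at most one by `hx`.
      · have key : ∑ a, x a * ((if a = i then v else 0) + ∑ s, ∑ b,
              matR Λ f (i, s) (a, b) • ((p b, x b) * d s)).2 - ((n + 1 : ℕ) : ℂ) • (x i * v.2) =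
            x i * (∑ a, x a * (d a).2 - (n : ℂ) • v.2) +
            ∑ s, (∑ ab : I × I, (matR Λ f - 1) (i, s) ab • (x ab.1 * x ab.2)) * (d s).2 := by
          have h₄ : ∀ s, ∑ ab : I × I, (matR Λ f - 1) (i, s) ab • (x ab.1 * x ab.2) =
              ∑ a, ∑ b, matR Λ f (i, s) (a, b) • (x a * x b) - x i * x s := by
            intro s
            simp [sub_smul, Matrix.one_apply, ite_smul, Fintype.sum_prod_type]
          simp only [h₄, sub_mul, Finset.sum_sub_distrib, Prod.snd_add, mul_add, mul_sub,
            Finset.sum_add_distrib, apply_ite Prod.snd, Prod.snd_zero, mul_ite, mul_zero,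
            Finset.sum_ite_eq', Finset.mem_univ, if_true, Finset.mul_sum, mul_assoc, Prod.snd_sum,
            Prod.smul_snd, Prod.snd_mul, mul_smul_comm, Finset.sum_mul, smul_mul_assoc]
          rw [Finset.sum_comm, Nat.cast_succ, add_smul, one_smul]
          abel
        change _ - ((n + 1 : ℕ) : ℂ) • (x i * v.2) ∈ _
        rw [key]
        exact add_mem (x_mul_mem_filtX i h₃) (Submodule.sum_mem _ fun s _ =>
          mul_filt_le _ _ n (Submodule.mul_mem_mul (hx (i, s)) (snd_mem_filtX n (h₁ s))))

/-- A homogeneous word whose value in `B` has lower degree also has lower degree in `C`. -/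
theorem snd_mem_of_fst_mem [StarRing A] (hG : IsInhomogeneous Λ inc p)
    (hd : IsDescribedBy Λ inc p f η T) (hΛ : IsIrrep Λ) (hs : ∀ i j, star (Λ i j) = Λ i j)
    (hx : ∀ kl : I × I, ∑ ij : I × I, (matR Λ f - 1) kl ij • (x ij.1 * x ij.2) ∈
      Submodule.span ℂ (insert 1 (Set.range x))) (n : ℕ) {u : B × C}
    (hu : u ∈ words p x (n + 1)) (h : u.1 ∈ filtB inc p n) : u.2 ∈ filtX x n := by
  induction n generalizing u with
  | zero =>
    obtain ⟨c, rfl⟩ := Submodule.mem_one.1 hu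
    have hc : algebraMap ℂ B c = 0 := h
    have : Nontrivial B := by
      obtain ⟨i, hi⟩ := hG.exists_notMem
      exact ⟨p i, inc 0, fun h => hi ⟨0, h.symm⟩⟩
    rw [map_eq_zero_iff _ (algebraMap ℂ B).injective] at hc
    simp [hc]
  | succ n ih =>
    obtain ⟨d, h₁, h₂, h₃⟩ := exists_twisted_derivative hG hd hΛ.isRep hx (n + 1) hu
    obtain ⟨χ, hχ, hχp⟩ := hG.exists_dual hΛ
    -- The drop of degree of u.1 bounds Δ(u.1) a second time; comparison with the formula for d
    -- leaves only the part linear in p on the right.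
    have h₄ : ∑ m, ∑ a, (inc (Λ a m) * (d a).1) ⊗ₜ[ℂ] p m ∈
        tens (filtB inc p n) ⊤ ⊔ tens ⊤ (incRange inc) := by
      have h₅ := sub_mem (sup_le_sup_left (tens_mono le_top le_rfl) _ (hG.comul_filtB n h))
        (sup_le_sup_left (tens_mono le_top le_rfl) _ h₂)
      rwa [sub_sub_cancel] at h₅
    obtain ⟨e, he, e', he', hee⟩ := Submodule.mem_sup.1 h₄
    -- The functional χ_m on the right leg kills A and picks the coefficient of p_m.
    have h₆ : ∀ m, ∑ a, inc (Λ a m) * (d a).1 ∈ filtB inc p n := by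
      intro m
      have h := congrArg (sliceRight (χ m)) hee
      rw [map_add, sliceRight_eq_zero (φ := χ m) ?_ he', add_zero] at h
      · convert sliceRight_mem (χ m) he using 1
        rw [h]
        simp only [map_sum, sliceRight_tmul, hχp]
        simp [ite_smul, Finset.sum_ite_irrel]
      · rintro _ ⟨a, rfl⟩
        exact hχ m a
    -- Invert Λ by the adjoint of the antipode, which lies in A and so keeps the degree.
    have h₇ : ∀ r, (d r).1 ∈ filtB inc p n := by
      intro r
      have h : ∑ m, inc (star (HopfAlgebra.antipode ℂ (Λ m r))) * ∑ a, inc (Λ a m) * (d a).1 ∈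
          filtB inc p n := Submodule.sum_mem _ fun m _ => incRange_mul_filtB inc p n
            (Submodule.mul_mem_mul (inc_mem_incRange inc _) (h₆ m))
      convert h using 1
      simp only [Finset.mul_sum, ← mul_assoc, ← map_mul]
      rw [Finset.sum_comm]
      simp only [← Finset.sum_mul, ← map_sum inc, hΛ.isRep.star_antipode_mul hs]
      simp [apply_ite inc, ite_mul]
    -- The induction hypothesis applies to each d_a, whose B-value drops in degree too. Euler's
    -- formula then bounds (n + 1) u.2, and n + 1 is invertible in ℂ.
    have h₈ : ((n + 1 : ℕ) : ℂ) • u.2 ∈ filtX x (n + 1) := by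
      have := sub_mem (Submodule.sum_mem (t := Finset.univ) _ fun a _ =>
        x_mul_mem_filtX (x := x) a (ih (h₁ a) (h₇ a))) h₃
      rwa [sub_sub_cancel] at this
    rwa [Submodule.smul_mem_iff _ (Nat.cast_ne_zero.2 n.succ_ne_zero)] at h₈

omit [Fintype I] [DecidableEq I] in
theorem filtX_le_sup (p : I → B) (x : I → C) (n : ℕ) :
    filtX x (n + 1) ≤ (words p x (n + 1)).map (LinearMap.snd ℂ B C) ⊔ filtX x n := by
  induction n with
  | zero =>
    rintro _ ⟨c, rfl⟩
    exact Submodule.mem_sup_left ⟨c • 1, ⟨c, rfl⟩, rfl⟩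
  | succ n ih =>
    refine Submodule.mul_le.2 fun a ha c hc => ?_
    induction ha using Submodule.span_induction with
    | mem a ha =>
      rcases ha with rfl | ⟨i, rfl⟩
      · rw [one_mul]
        exact Submodule.mem_sup_right hc
      · obtain ⟨_, ⟨u, hu, rfl⟩, c', hc', rfl⟩ := Submodule.mem_sup.1 (ih hc)
        rw [mul_add]
        exact Submodule.add_mem_sup ⟨_, pair_mul_mem_words i hu, rfl⟩ (x_mul_mem_filtX i hc')
    | zero => simp
    | add a b _ _ ha hb => rw [add_mul]; exact add_mem ha hb
    | smul r a _ ha => rw [smul_mul_assoc]; exact Submodule.smul_mem _ r ha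

omit [Fintype I] [DecidableEq I] in
theorem exists_mem_filtX (hx : Algebra.adjoin ℂ (Set.range x) = ⊤) (c : C) :
    ∃ n, c ∈ filtX x (n + 1) := by
  have hc : c ∈ Algebra.adjoin ℂ (Set.range x) := hx ▸ Algebra.mem_top
  have key : ∀ a ∈ Algebra.adjoin ℂ (Set.range x), ∀ n, ∀ b ∈ filtX x (n + 1),
      ∃ m, a * b ∈ filtX x (m + 1) := by
    intro a ha
    induction ha using Algebra.adjoin_induction with
    | mem a ha =>
      obtain ⟨i, rfl⟩ := ha
      exact fun n b hb => ⟨n + 1, x_mul_mem_filtX i hb⟩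
    | algebraMap r =>
      intro n b hb
      rw [← Algebra.smul_def]
      exact ⟨n, Submodule.smul_mem _ r hb⟩
    | add a a' _ _ ha ha' =>
      intro n b hb
      obtain ⟨m, hm⟩ := ha n b hb
      obtain ⟨m', hm'⟩ := ha' n b hb
      have mono : Monotone (filtX x) := monotone_nat_of_le_succ (filtX_le_succ x)
      rw [add_mul]
      exact ⟨m + m', add_mem (mono (by omega) hm) (mono (by omega) hm')⟩
    | mul a a' _ _ ha ha' =>
      intro n b hb
      obtain ⟨m, hm⟩ := ha' n b hb
      rw [mul_assoc]
      exact ha m _ hm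
  simpa using key c hc 0 1 (Submodule.one_le.1 le_rfl)

section Coaction

variable (Ψ : C →ₐ[ℂ] B ⊗[ℂ] C)
  (hΨ : ∀ i, Ψ (x i) = ∑ j, inc (Λ i j) ⊗ₜ[ℂ] x j + p i ⊗ₜ[ℂ] (1 : C))

include hΨ

omit [DecidableEq I] in
theorem coaction_snd_sub_mem (n : ℕ) {u : B × C} (hu : u ∈ words p x (n + 1)) :
    Ψ u.2 - u.1 ⊗ₜ[ℂ] (1 : C) ∈ tens (filtB inc p n) ⊤ :=
  (coaction_sub_mem (AlgHom.fst ℂ B C) (Ψ.comp (AlgHom.snd ℂ B C)) (fun i => (p i, x i)) x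
    (fun _ => rfl) hΨ n hu).2

omit [DecidableEq I] in
theorem coaction_mem_tens (n : ℕ) {c : C} (hc : c ∈ filtX x n) :
    Ψ c ∈ tens (filtB inc p n) ⊤ := by
  induction n generalizing c with
  | zero =>
    rw [(Submodule.mem_bot ℂ).1 hc, map_zero]
    exact zero_mem _
  | succ n ih =>
    obtain ⟨_, ⟨u, hu, rfl⟩, c', hc', rfl⟩ := Submodule.mem_sup.1 (filtX_le_sup p x n hc)
    have mono := tens_mono (filtB_mono inc p n.le_succ) (le_refl (⊤ : Submodule ℂ C))
    have h := add_mem (mono (coaction_snd_sub_mem Ψ hΨ n hu))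
      (tmul_mem_tens (fst_mem_filtB (inc := inc) _ hu) (Submodule.mem_top (x := (1 : C))))
    rw [sub_add_cancel] at h
    rw [map_add]
    exact add_mem h (mono (ih hc'))

/-- In an algebra generated by the `x i` with the quadratic relations, only the scalars are
invariant under the translations. -/
theorem mem_span_one_of_coaction_mem [StarRing A] (hG : IsInhomogeneous Λ inc p)
    (hd : IsDescribedBy Λ inc p f η T) (hΛ : IsIrrep Λ) (hs : ∀ i j, star (Λ i j) = Λ i j)
    (hx : ∀ kl : I × I, ∑ ij : I × I, (matR Λ f - 1) kl ij • (x ij.1 * x ij.2) ∈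
      Submodule.span ℂ (insert 1 (Set.range x)))
    (hgen : Algebra.adjoin ℂ (Set.range x) = ⊤) {c : C}
    (hc : Ψ c ∈ tens (incRange inc) ⊤) : c ∈ Submodule.span ℂ {(1 : C)} := by
  nontriviality C
  obtain ⟨g, hg⟩ := Module.Projective.exists_dual_eq_one ℂ (one_ne_zero (α := C))
  obtain ⟨n, hn⟩ := exists_mem_filtX hgen c
  rw [← Submodule.one_eq_span]
  induction n with
  | zero => exact hn
  | succ n ih =>
    obtain ⟨_, ⟨u, hu, rfl⟩, c', hc', rfl⟩ := Submodule.mem_sup.1 (filtX_le_sup p x (n + 1) hn)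
    refine ih (add_mem (snd_mem_of_fst_mem hG hd hΛ hs hx (n + 1) hu ?_) hc')
    -- The leading part u.1 ⊗ 1 of Ψ c must have lower left degree, since Ψ c itself has left leg in
    -- A. Evaluating the right leg by g, with g(1) = 1, shows that u.1 drops in degree; hence so
    -- does u.2, and c descends one step.
    have h := sub_mem (sub_mem (tens_mono (incRange_le_filtB inc p n) le_rfl hc)
      (coaction_mem_tens Ψ hΨ (n + 1) hc')) (coaction_snd_sub_mem Ψ hΨ (n + 1) hu)
    simpa [hg] using sliceRight_mem g h

end Coaction

end LeadingTerm
-- The relators and their transformation law.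
section Relators

variable {I A B : Type*} [Fintype I] [DecidableEq I] [Ring A] [HopfAlgebra ℂ A]
  [Ring B] [Bialgebra ℂ B] {Λ : Matrix I I A} {inc : A →ₐc[ℂ] B} {p : I → B}
  {f : I → I → A →ₗ[ℂ] ℂ} {η : I → A →ₗ[ℂ] ℂ} {T : I × I → ℂ}

/-- The value of the relator `(R - 1)(x ⊗ x - Z x + T)` at elements `x i` of an algebra. -/
noncomputable def relator {D : Type*} [Ring D] [Algebra ℂ D] (R : Matrix (I × I) (I × I) ℂ)
    (Z : Matrix (I × I) I ℂ) (T : I × I → ℂ) (x : I → D) (kl : I × I) : D :=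
  ∑ ij : I × I, (R - 1) kl ij •
    (x ij.1 * x ij.2 - ∑ m, Z ij m • x m + algebraMap ℂ D (T ij))

theorem map_relator {D E : Type*} [Ring D] [Algebra ℂ D] [Ring E] [Algebra ℂ E] (g : D →ₐ[ℂ] E)
    (R : Matrix (I × I) (I × I) ℂ) (Z : Matrix (I × I) I ℂ) (T : I × I → ℂ) (x : I → D)
    (kl : I × I) : g (relator R Z T x kl) = relator R Z T (g ∘ x) kl := by
  simp [relator]

theorem sum_smul_sum_smul {J K L M : Type*} [Fintype K] [Fintype L] [AddCommGroup M] [Module ℂ M]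
    (P : Matrix J K ℂ) (Q : Matrix K L ℂ) (v : L → M) (j : J) :
    ∑ k, P j k • ∑ l, Q k l • v l = ∑ l, (P * Q) j l • v l := by
  simp only [Finset.smul_sum, smul_smul, Matrix.mul_apply, Finset.sum_smul]
  exact Finset.sum_comm

theorem sum_one_smul {K M : Type*} [Fintype K] [DecidableEq K] [AddCommGroup M] [Module ℂ M]
    (v : K → M) (j : K) : ∑ k, (1 : Matrix K K ℂ) j k • v k = v j := by
  simp [Matrix.one_apply, ite_smul]

theorem sub_one_mul_add_one {K : Type*} [Fintype K] [DecidableEq K] {R : Matrix K K ℂ}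
    (hR : R * R = 1) : (R - 1) * (R + 1) = 0 := by
  rw [sub_mul, mul_add, hR, mul_one, one_mul]
  abel

theorem add_one_mul_sub_one {K : Type*} [Fintype K] [DecidableEq K] {R : Matrix K K ℂ}
    (hR : R * R = 1) : (R + 1) * (R - 1) = 0 := by
  rw [add_mul, mul_sub, hR, mul_one, one_mul]
  abel

/-- This is (R - 1)(R + 1) = R² - 1 = 0, in the form that removes the mixed terms from the
transformed relators. -/
theorem sum_sub_one_smul_add {K M : Type*} [Fintype K] [DecidableEq K] [AddCommGroup M]
    [Module ℂ M] {R : Matrix K K ℂ} (hR : R * R = 1) (v : K → M) (j : K) :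
    ∑ k, (R - 1) j k • (∑ l, R k l • v l + v k) = 0 := by
  have h : ∀ k, ∑ l, R k l • v l + v k = ∑ l, (R + 1) k l • v l := fun k => by
    simp only [Matrix.add_apply, add_smul, Finset.sum_add_distrib, sum_one_smul]
  simp only [h, sum_smul_sum_smul, sub_one_mul_add_one hR, Matrix.zero_apply, zero_smul,
    Finset.sum_const_zero]

theorem IsInhomogeneous.sub_one_intertwines [StarRing A] (hG : IsInhomogeneous Λ inc p)
    (hd : IsDescribedBy Λ inc p f η T) (hΛ : IsIrrep Λ) (hs : ∀ i j, star (Λ i j) = Λ i j)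
    (ij st : I × I) :
    ∑ kl : I × I, (matR Λ f - 1) ij kl • (Λ kl.1 st.1 * Λ kl.2 st.2) =
      ∑ kl : I × I, (matR Λ f - 1) kl st • (Λ ij.1 kl.1 * Λ ij.2 kl.2) := by
  simp only [Matrix.sub_apply, sub_smul, Finset.sum_sub_distrib, sum_one_smul,
    hG.matR_intertwines hd hΛ hs]
  simp [Matrix.one_apply, ite_smul]

theorem IsInhomogeneous.sum_sub_one_smul_tmul [StarRing A] (hG : IsInhomogeneous Λ inc p)
    (hd : IsDescribedBy Λ inc p f η T) (hΛ : IsIrrep Λ) (hs : ∀ i j, star (Λ i j) = Λ i j)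
    {D : Type*} [Ring D] [Algebra ℂ D] (v : I × I → D) (kl : I × I) :
    ∑ ij : I × I, (matR Λ f - 1) kl ij • ∑ mn : I × I, inc (Λ ij.1 mn.1 * Λ ij.2 mn.2) ⊗ₜ[ℂ] v mn =
      ∑ mn : I × I, inc (Λ kl.1 mn.1 * Λ kl.2 mn.2) ⊗ₜ[ℂ]
        ∑ ij : I × I, (matR Λ f - 1) mn ij • v ij := by
  have h : ∀ st, ∑ ij : I × I, (matR Λ f - 1) kl ij • (inc (Λ ij.1 st.1 * Λ ij.2 st.2) ⊗ₜ[ℂ] v st) =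
      ∑ mn : I × I, inc (Λ kl.1 mn.1 * Λ kl.2 mn.2) ⊗ₜ[ℂ] ((matR Λ f - 1) mn st • v st) := by
    intro st
    have h := congrArg (fun a => inc a ⊗ₜ[ℂ] v st) (hG.sub_one_intertwines hd hΛ hs kl st)
    simpa only [map_sum, map_smul, TensorProduct.sum_tmul, TensorProduct.smul_tmul',
      TensorProduct.tmul_smul] using h
  simp only [Finset.smul_sum, TensorProduct.tmul_sum]
  rw [Finset.sum_comm, Finset.sum_comm (f := fun mn ij => _ ⊗ₜ[ℂ] _)]
  exact Finset.sum_congr rfl fun st _ => h st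

/-- The relators transform like `Λ ⊗ Λ` under `x i ↦ Λ_ij ⊗ x_j + p_i ⊗ 1`. -/
theorem IsInhomogeneous.relator_coaction [StarRing A] (hG : IsInhomogeneous Λ inc p)
    (hd : IsDescribedBy Λ inc p f η T) (hΛ : IsIrrep Λ) (hs : ∀ i j, star (Λ i j) = Λ i j)
    {D : Type*} [Ring D] [Algebra ℂ D] (x : I → D) (kl : I × I) :
    relator (matR Λ f) (matZ Λ η) T
      (fun i => ∑ j, inc (Λ i j) ⊗ₜ[ℂ] x j + p i ⊗ₜ[ℂ] (1 : D)) kl =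
      ∑ mn : I × I, inc (Λ kl.1 mn.1 * Λ kl.2 mn.2) ⊗ₜ[ℂ]
        relator (matR Λ f) (matZ Λ η) T x mn := by
  -- W collects the mixed terms Λ_im p_j ⊗ x_m. The opposite mixed terms p_i Λ_jn ⊗ x_n become RW
  -- after reordering, together with the Z-terms needed on both sides.
  set W : I × I → B ⊗[ℂ] D := fun ij => ∑ m, (inc (Λ ij.1 m) * p ij.2) ⊗ₜ[ℂ] x m with hW
  have entry : ∀ ij : I × I,
      (∑ j, inc (Λ ij.1 j) ⊗ₜ[ℂ] x j + p ij.1 ⊗ₜ[ℂ] (1 : D)) *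
        (∑ j, inc (Λ ij.2 j) ⊗ₜ[ℂ] x j + p ij.2 ⊗ₜ[ℂ] (1 : D)) -
        ∑ m, matZ Λ η ij m • (∑ j, inc (Λ m j) ⊗ₜ[ℂ] x j + p m ⊗ₜ[ℂ] (1 : D)) +
        algebraMap ℂ (B ⊗[ℂ] D) (T ij) =
      ∑ mn : I × I, inc (Λ ij.1 mn.1 * Λ ij.2 mn.2) ⊗ₜ[ℂ]
          (x mn.1 * x mn.2 - ∑ s, matZ Λ η mn s • x s + algebraMap ℂ D (T mn)) +
        (∑ st, matR Λ f ij st • W st + W ij) +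
        (p ij.1 * p ij.2 - ∑ s, matZ Λ η ij s • p s + algebraMap ℂ B (T ij)
          - inc (∑ mn : I × I, T mn • (Λ ij.1 mn.1 * Λ ij.2 mn.2))) ⊗ₜ[ℂ] (1 : D) := by
    rintro ⟨i, j⟩
    have h₁ : ∑ n, (p i * inc (Λ j n)) ⊗ₜ[ℂ] x n = ∑ st, matR Λ f (i, j) st • W st +
        ∑ s, matZ Λ η (i, j) s • ∑ n, inc (Λ s n) ⊗ₜ[ℂ] x n -
        ∑ mn : I × I, inc (Λ i mn.1 * Λ j mn.2) ⊗ₜ[ℂ] ∑ s, matZ Λ η mn s • x s := by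
      simp only [hd.p_mul_inc hΛ.isRep, hW, inhomTerm, map_sub, map_sum, map_smul,
        TensorProduct.add_tmul, TensorProduct.sub_tmul, TensorProduct.sum_tmul,
        Finset.sum_add_distrib, Finset.sum_sub_distrib, Finset.smul_sum, TensorProduct.tmul_sum,
        TensorProduct.tmul_smul, TensorProduct.smul_tmul']
      rw [add_sub_assoc]
      refine congrArg₂ (· + ·) Finset.sum_comm (congrArg₂ (· - ·) Finset.sum_comm Finset.sum_comm)
    have h₂ : algebraMap ℂ (B ⊗[ℂ] D) (T (i, j)) = algebraMap ℂ B (T (i, j)) ⊗ₜ[ℂ] (1 : D) := rfl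
    have h₃ : inc (∑ mn : I × I, T mn • (Λ i mn.1 * Λ j mn.2)) ⊗ₜ[ℂ] (1 : D) =
        ∑ mn : I × I, inc (Λ i mn.1 * Λ j mn.2) ⊗ₜ[ℂ] algebraMap ℂ D (T mn) := by
      simp only [map_sum, map_smul, TensorProduct.sum_tmul, Algebra.algebraMap_eq_smul_one,
        TensorProduct.tmul_smul, TensorProduct.smul_tmul']
    have h₄ : (∑ m, inc (Λ i m) ⊗ₜ[ℂ] x m) * ∑ n, inc (Λ j n) ⊗ₜ[ℂ] x n =
        ∑ mn : I × I, inc (Λ i mn.1 * Λ j mn.2) ⊗ₜ[ℂ] (x mn.1 * x mn.2) := by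
      simp only [Finset.sum_mul_sum, Fintype.sum_prod_type, Algebra.TensorProduct.tmul_mul_tmul,
        map_mul]
    have h₅ : (∑ m, inc (Λ i m) ⊗ₜ[ℂ] x m) * (p j ⊗ₜ[ℂ] (1 : D)) = W (i, j) := by
      simp [hW, Finset.sum_mul]
    have h₆ : (p i ⊗ₜ[ℂ] (1 : D)) * ∑ n, inc (Λ j n) ⊗ₜ[ℂ] x n =
        ∑ n, (p i * inc (Λ j n)) ⊗ₜ[ℂ] x n := by
      simp [Finset.mul_sum]
    have h₇ : ∑ m, matZ Λ η (i, j) m • p m ⊗ₜ[ℂ] (1 : D) =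
        (∑ m, matZ Λ η (i, j) m • p m) ⊗ₜ[ℂ] (1 : D) := by
      simp only [TensorProduct.sum_tmul, TensorProduct.smul_tmul']
    simp only [add_mul, mul_add, h₄, h₅, h₆, h₁, h₂, h₃, h₇, smul_add, Finset.sum_add_distrib,
      TensorProduct.sub_tmul, TensorProduct.add_tmul, TensorProduct.tmul_sub,
      TensorProduct.tmul_add, Finset.sum_sub_distrib, Algebra.TensorProduct.tmul_mul_tmul, mul_one]
    abel
  have hq : ∑ ij : I × I, (matR Λ f - 1) kl ij •
      ((p ij.1 * p ij.2 - ∑ s, matZ Λ η ij s • p s + algebraMap ℂ B (T ij)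
        - inc (∑ mn : I × I, T mn • (Λ ij.1 mn.1 * Λ ij.2 mn.2))) ⊗ₜ[ℂ] (1 : D)) = 0 := by
    simp only [TensorProduct.smul_tmul', ← TensorProduct.sum_tmul]
    rw [hd.quadratic kl, TensorProduct.zero_tmul]
  simp only [relator, entry]
  simp only [smul_add _ (_ + _), Finset.sum_add_distrib]
  rw [hq, add_zero, ← hG.sum_sub_one_smul_tmul hd hΛ hs]
  simp only [smul_add _ (∑ mn : I × I, _) (_ + _), Finset.sum_add_distrib]
  rw [sum_sub_one_smul_add hd.R_sq, add_zero]

end Relators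
-- Reality conditions for R, Z and T.
section Reality

variable {I A B : Type*} [Fintype I] [DecidableEq I] [Ring A] [HopfAlgebra ℂ A]
  [StarRing A] [StarModule ℂ A] [Ring B] [Bialgebra ℂ B] [StarRing B] [StarModule ℂ B]
  {Λ : Matrix I I A} {inc : A →ₐc[ℂ] B} {p : I → B}
  {f : I → I → A →ₗ[ℂ] ℂ} {η : I → A →ₗ[ℂ] ℂ} {T : I × I → ℂ}

/-- The adjoint of the commutation rule expresses Λ_jn p_i through products p_t Λ_sn; applying the
rule once more returns to the normal order. Both sides are then comparable: the coefficients of Λp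
give the condition on R, the A-parts the condition on Z. -/
theorem IsStarCompatible.star_p_mul_inc (hst : IsStarCompatible inc p)
    (hd : IsDescribedBy Λ inc p f η T) (hΛ : IsRep Λ) (hs : ∀ i j, star (Λ i j) = Λ i j)
    (i j n : I) :
    inc (Λ j n) * p i = ∑ uv : I × I, (∑ st : I × I, star (matR Λ f (i, j) st) *
        matR Λ f st.swap uv) • (inc (Λ uv.1 n) * p uv.2) +
      inc (∑ st : I × I, star (matR Λ f (i, j) st) • inhomTerm Λ η st.swap n +
        star (inhomTerm Λ η (i, j) n)) := by
  have h := congrArg star (hd.p_mul_inc hΛ i j n)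
  simp only [star_mul, star_add, star_sum, star_smul, ← hst.inc_star, hs, hst.star_p] at h
  rw [h, map_add, ← add_assoc]
  congr 1
  simp only [map_sum, map_smul, hd.p_mul_inc hΛ, smul_add, Finset.sum_add_distrib, Finset.sum_smul,
    Finset.smul_sum, smul_smul]
  exact congrArg₂ _ Finset.sum_comm rfl

theorem IsStarCompatible.sum_star_matR_mul (hst : IsStarCompatible inc p)
    (hG : IsInhomogeneous Λ inc p) (hd : IsDescribedBy Λ inc p f η T) (hΛ : IsIrrep Λ)
    (hs : ∀ i j, star (Λ i j) = Λ i j) (i j : I) (uv : I × I) :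
    ∑ st : I × I, star (matR Λ f (i, j) st) * matR Λ f st.swap uv = if (j, i) = uv then 1 else 0 := by
  have h := hG.eq_zero_of_sum_mul_mem hΛ hs (fun uv => ∑ st : I × I, star (matR Λ f (i, j) st) *
    matR Λ f st.swap uv - if (j, i) = uv then 1 else 0) fun n => by
    simp only [sub_smul, Finset.sum_sub_distrib, ite_smul, one_smul, zero_smul,
      Finset.sum_ite_eq, Finset.mem_univ, if_true]
    rw [hst.star_p_mul_inc hd hΛ.isRep hs i j n, sub_add_cancel_left]
    exact neg_mem (inc_mem_incRange inc _)
  exact sub_eq_zero.1 (congrFun h uv)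

/-- The reality condition for `R`. -/
theorem IsStarCompatible.star_matR (hst : IsStarCompatible inc p)
    (hG : IsInhomogeneous Λ inc p) (hd : IsDescribedBy Λ inc p f η T) (hΛ : IsIrrep Λ)
    (hs : ∀ i j, star (Λ i j) = Λ i j) (ij st : I × I) :
    star (matR Λ f ij st) = matR Λ f ij.swap st.swap := by
  let R' : Matrix (I × I) (I × I) ℂ := fun ij st => star (matR Λ f ij.swap st.swap)
  have h : R' * matR Λ f = 1 := by
    ext ij uv
    rw [Matrix.mul_apply, Matrix.one_apply]
    refine Eq.trans ?_ (hst.sum_star_matR_mul hG hd hΛ hs ij.2 ij.1 uv)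
    exact Fintype.sum_equiv (Equiv.prodComm I I) _ _ fun _ => rfl
  -- A left inverse of R must be R itself, because R² = 1.
  have h' : R' = matR Λ f := by
    rw [← mul_one R', ← hd.R_sq, ← mul_assoc, h, one_mul]
  have := congrFun (congrFun h' ij.swap) st.swap
  simpa [R'] using this

theorem IsStarCompatible.sum_matR_smul_inhomTerm (hst : IsStarCompatible inc p)
    (hG : IsInhomogeneous Λ inc p) (hd : IsDescribedBy Λ inc p f η T) (hΛ : IsIrrep Λ)
    (hs : ∀ i j, star (Λ i j) = Λ i j) (ij : I × I) (n : I) :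
    ∑ st : I × I, matR Λ f ij st • inhomTerm Λ η st n + star (inhomTerm Λ η ij.swap n) = 0 := by
  obtain ⟨j, i⟩ := ij
  have h := hst.star_p_mul_inc hd hΛ.isRep hs i j n
  simp only [hst.sum_star_matR_mul hG hd hΛ hs, ite_smul, one_smul, zero_smul,
      Finset.sum_ite_eq, Finset.mem_univ, if_true] at h
  have h' := hG.inc_injective ((left_eq_add.1 h).trans (map_zero inc).symm)
  rw [← h']
  congr 1
  refine Fintype.sum_equiv (Equiv.prodComm I I) _ _ fun st => ?_
  rw [hst.star_matR hG hd hΛ hs]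
  simp

/-- The matrix `conj Z_{ji,s}`. -/
def conjZ (Z : Matrix (I × I) I ℂ) : Matrix (I × I) I ℂ := fun ij s => star (Z ij.swap s)

omit [DecidableEq I] [StarRing A] [StarModule ℂ A] in
theorem inhomTerm_eq (Λ : Matrix I I A) (η : I → A →ₗ[ℂ] ℂ) (ij : I × I) (n : I) :
    inhomTerm Λ η ij n = ((matZ Λ η).map (algebraMap ℂ A) * Λ -
      (Λ ⊗ₖ Λ) * (matZ Λ η).map (algebraMap ℂ A)) ij n := by
  simp [inhomTerm, Matrix.mul_apply, Algebra.smul_def, ← Algebra.commutes]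

omit [DecidableEq I] in
theorem star_inhomTerm (η : I → A →ₗ[ℂ] ℂ) (hs : ∀ i j, star (Λ i j) = Λ i j) (ij : I × I)
    (n : I) : star (inhomTerm Λ η ij.swap n) =
      ((conjZ (matZ Λ η)).map (algebraMap ℂ A) * Λ -
        (Λ ⊗ₖ Λ) * (conjZ (matZ Λ η)).map (algebraMap ℂ A)) ij n := by
  simp only [inhomTerm, star_sub, star_sum, star_smul, star_mul, hs, Matrix.sub_apply,
    Matrix.mul_apply, Matrix.map_apply, Matrix.kroneckerMap_apply, ← Algebra.commutes (R := ℂ),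
    ← Algebra.smul_def, conjZ]
  congr 1
  exact Fintype.sum_equiv (Equiv.prodComm I I) _ _ fun st => rfl

omit [StarRing A] [StarModule ℂ A] in
theorem isIrrep_submatrix {n m : Type*} [Fintype n] [DecidableEq n] [Fintype m] [DecidableEq m]
    {v : Matrix n n A} (hv : IsIrrep v) (e : m ≃ n) : IsIrrep (v.submatrix e e) where
  isRep :=
    { comul := fun i j => by
        simp only [Matrix.submatrix_apply, hv.isRep.comul]
        exact (e.sum_comp fun k => v (e i) k ⊗ₜ[ℂ] v k (e j)).symm
      counit := fun i j => by simp [hv.isRep.counit] }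
  nonempty := by
    have := hv.nonempty
    exact e.nonempty
  eq_bot_or_eq_top := fun W hW => by
    have h : IsInvariant v (W.comap (LinearMap.funLeft ℂ ℂ e)) := fun φ y hy => by
      have h := hW φ _ hy
      rw [← Matrix.submatrix_map, Matrix.submatrix_mulVec_equiv] at h
      have hy' : LinearMap.funLeft ℂ ℂ e y ∘ e.symm = y := by
        ext i
        simp [LinearMap.funLeft_apply]
      rwa [hy'] at h
    have key : ∀ w : m → ℂ, LinearMap.funLeft ℂ ℂ e (w ∘ e.symm) = w := fun w => by
      ext i
      simp [LinearMap.funLeft_apply]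
    rcases hv.eq_bot_or_eq_top _ h with h | h
    · left
      rw [Submodule.eq_bot_iff]
      intro w hw
      have hw' : w ∘ e.symm ∈ W.comap (LinearMap.funLeft ℂ ℂ e) := by
        rwa [Submodule.mem_comap, key]
      rw [h, Submodule.mem_bot] at hw'
      rw [← key w, hw', map_zero]
    · right
      rw [eq_top_iff]
      intro w _
      rw [← key w]
      exact h.ge (Submodule.mem_top (x := w ∘ e.symm))

omit [StarRing A] [StarModule ℂ A] in
theorem isIrrep_one : IsIrrep (1 : Matrix (Fin 1) (Fin 1) A) where
  isRep :=
    { comul := fun i j => by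
        simp [Matrix.one_apply, Subsingleton.elim i j, Subsingleton.elim j 0,
          Algebra.TensorProduct.one_def]
      counit := fun i j => by simp [Matrix.one_apply, Subsingleton.elim i j] }
  nonempty := inferInstance
  eq_bot_or_eq_top := fun W _ => by
    by_cases hW : W = ⊥
    · exact Or.inl hW
    · obtain ⟨x, hx, hx0⟩ := Submodule.exists_mem_ne_zero_of_ne_bot hW
      have h0 : x 0 ≠ 0 := fun h => hx0 (funext fun i => by rw [Subsingleton.elim i 0, h]; rfl)
      refine Or.inr (eq_top_iff.2 fun y _ => ?_)
      have : y = (y 0 / x 0) • x := funext fun i => by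
        rw [Subsingleton.elim i 0, Pi.smul_apply, smul_eq_mul, div_mul_cancel₀ _ h0]
      rw [this]
      exact W.smul_mem _ hx

/-- The standing Mor hypothesis with v = Λ and w trivial. The relabelling only serves to index Λ by
`Fin`, as that hypothesis demands. -/
theorem IsHomogeneousPart.eq_zero_of_isMor (hH : IsHomogeneousPart Λ) (Y : Matrix (I × I) I ℂ)
    (hY : IsMor Λ (Λ ⊗ₖ Λ) Y) : Y = 0 := by
  let e := (Fintype.equivFin I).symm
  let M : Matrix (I × Fin (Fintype.card I) × Fin 1) (Fin (Fintype.card I) × Fin 1) ℂ :=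
    Matrix.of fun ija kb => Y (ija.1, e ija.2.1) (e kb.1)
  have hM : M = 0 := by
    refine hH.mor_eq_zero _ 1 _ 1 (isIrrep_submatrix hH.irreducible e) isIrrep_one M ?_
    rw [IsMor]
    ext ⟨i, j, a⟩ ⟨k, b⟩
    have h := congrFun (congrFun hY (i, e j)) (e k)
    simp only [Matrix.mul_apply, Fintype.sum_prod_type, Matrix.map_apply,
      Matrix.kroneckerMap_apply] at h
    simp only [M, Matrix.of_apply, Matrix.mul_apply, Fintype.sum_prod_type, Matrix.map_apply,
      Matrix.kroneckerMap_apply, Finset.univ_unique, Finset.sum_singleton, Matrix.submatrix_apply,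
      Subsingleton.elim a 0, Subsingleton.elim b 0, Fin.default_eq_zero, Matrix.one_apply_eq,
      mul_one]
    rw [e.sum_comp fun l => algebraMap ℂ A (Y (i, e j) l) * Λ l (e k), h]
    exact Finset.sum_congr rfl fun l _ => (e.sum_comp fun m => Λ i l * Λ (e j) m *
      algebraMap ℂ A (Y (l, m) (e k))).symm
  ext ⟨i, j⟩ k
  simpa [M] using congrFun (congrFun hM (i, e.symm j, 0)) (e.symm k, 0)

/-- The reality condition for `Z`. -/
theorem IsStarCompatible.conjZ_eq (hst : IsStarCompatible inc p) (hH : IsHomogeneousPart Λ)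
    (hG : IsInhomogeneous Λ inc p) (hd : IsDescribedBy Λ inc p f η T) :
    conjZ (matZ Λ η) = -(matR Λ f * matZ Λ η) := by
  have hΛ := hH.irreducible
  have hs := hH.star_Λ
  rw [eq_neg_iff_add_eq_zero]
  refine hH.eq_zero_of_isMor _ ?_
  set RA := (matR Λ f).map (algebraMap ℂ A) with hRA
  set ZA := (matZ Λ η).map (algebraMap ℂ A) with hZA
  set ZA' := (conjZ (matZ Λ η)).map (algebraMap ℂ A) with hZA'
  -- `inhomTerm` is the defect ZΛ - (Λ ⊗ Λ)Z of Z as an intertwiner. Since R commutes with Λ ⊗ Λ,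
  -- this identity says that conj Z + RZ has no defect.
  have h₁ : RA * (ZA * Λ - (Λ ⊗ₖ Λ) * ZA) + (ZA' * Λ - (Λ ⊗ₖ Λ) * ZA') = 0 := by
    ext ij n
    have h := hst.sum_matR_smul_inhomTerm hG hd hΛ hs ij n
    rw [star_inhomTerm η hs] at h
    rw [Matrix.add_apply, Matrix.mul_apply, Matrix.zero_apply, ← h]
    simp only [inhomTerm_eq, Algebra.smul_def]
    rfl
  have h₂ : RA * (Λ ⊗ₖ Λ) = (Λ ⊗ₖ Λ) * RA := by
    ext ij st
    simpa [hRA, Matrix.mul_apply, Algebra.smul_def, Algebra.commutes] using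
      hG.matR_intertwines hd hΛ hs ij st
  have h₃ : (conjZ (matZ Λ η) + matR Λ f * matZ Λ η).map (algebraMap ℂ A) = ZA' + RA * ZA := by
    rw [Matrix.map_add _ (map_add _), Matrix.map_mul]
  rw [IsMor, h₃, Matrix.add_mul, Matrix.mul_add, ← sub_eq_zero, ← h₁, Matrix.mul_sub,
    Matrix.mul_assoc, ← Matrix.mul_assoc _ RA, ← h₂, Matrix.mul_assoc]
  abel

/-- The numbers `conj T_{ji}`. -/
def conjT (T : I × I → ℂ) : I × I → ℂ := fun ij => star (T ij.swap)

theorem IsStarCompatible.sub_one_mul_conjZ (hst : IsStarCompatible inc p)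
    (hH : IsHomogeneousPart Λ) (hG : IsInhomogeneous Λ inc p)
    (hd : IsDescribedBy Λ inc p f η T) :
    (matR Λ f - 1) * conjZ (matZ Λ η) = (matR Λ f - 1) * matZ Λ η := by
  rw [hst.conjZ_eq hH hG hd, Matrix.mul_neg, ← Matrix.mul_assoc, sub_mul, hd.R_sq,
    one_mul, ← Matrix.neg_mul, neg_sub]

theorem sum_sub_one_smul_conjZ {R : Matrix (I × I) (I × I) ℂ} {Z : Matrix (I × I) I ℂ}
    (hZ : (R - 1) * conjZ Z = (R - 1) * Z) {M : Type*} [AddCommGroup M] [Module ℂ M] (x : I → M)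
    (kl : I × I) : ∑ ij, (R - 1) kl ij • ∑ m, conjZ Z ij m • x m =
      ∑ ij, (R - 1) kl ij • ∑ m, Z ij m • x m := by
  rw [sum_smul_sum_smul, sum_smul_sum_smul, hZ]

omit [Fintype I] in
theorem star_sub_one {R : Matrix (I × I) (I × I) ℂ}
    (hR : ∀ ij st, star (R ij st) = R ij.swap st.swap) (ij st : I × I) :
    star ((R - 1) ij st) = (R - 1) ij.swap st.swap := by
  by_cases h : ij = st
  · simp [hR, h]
  · simp [hR, Matrix.one_apply_ne h, Matrix.one_apply_ne (Prod.swap_injective.ne h)]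

omit [StarRing A] [StarModule ℂ A] [StarRing B] [StarModule ℂ B] in
/-- `Mor(I, Λ ⊗ Λ) ∩ ker (R + 1) = 0`, for vectors. -/
theorem eq_zero_of_invariant (hd : IsDescribedBy Λ inc p f η T)
    (h₂ : ∀ M : Matrix (I × I) Unit ℂ, IsMor (trivialRep A) (Λ ⊗ₖ Λ) M →
      (matR Λ f + 1) * M = 0 → M = 0) (S D : I × I → ℂ)
    (hS : ∀ kl, D kl = ∑ ij, (matR Λ f - 1) kl ij * S ij)
    (hD : ∀ kl, algebraMap ℂ A (D kl) = ∑ mn : I × I, D mn • (Λ kl.1 mn.1 * Λ kl.2 mn.2)) :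
    D = 0 := by
  have h := h₂ (Matrix.of fun kl _ => D kl) ?_ ?_
  · funext kl
    exact congrFun (congrFun h kl) ()
  · rw [IsMor]
    ext kl u
    simpa [trivialRep, Matrix.mul_apply, Algebra.smul_def, Algebra.commutes] using hD kl
  -- A vector in the image of R - 1 is killed by R + 1.
  · have : (Matrix.of fun kl (_ : Unit) => D kl) =
        (matR Λ f - 1) * Matrix.of fun ij (_ : Unit) => S ij := by
      ext kl u
      simp only [Matrix.of_apply, hS, Matrix.mul_apply]
    rw [this, ← Matrix.mul_assoc, add_one_mul_sub_one hd.R_sq, Matrix.zero_mul]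

/-- The reality condition for `T`. -/
theorem IsStarCompatible.sub_one_mul_conjT (hst : IsStarCompatible inc p)
    (hH : IsHomogeneousPart Λ) (hG : IsInhomogeneous Λ inc p)
    (hd : IsDescribedBy Λ inc p f η T)
    (h₂ : ∀ M : Matrix (I × I) Unit ℂ, IsMor (trivialRep A) (Λ ⊗ₖ Λ) M →
      (matR Λ f + 1) * M = 0 → M = 0) (kl : I × I) :
    ∑ ij, (matR Λ f - 1) kl ij * conjT T ij = ∑ ij, (matR Λ f - 1) kl ij * T ij := by
  have hΛ := hH.irreducible
  have hs := hH.star_Λ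
  have hZ := hst.sub_one_mul_conjZ hH hG hd
  have hR := hst.star_matR hG hd hΛ hs
  set D : I × I → ℂ := fun kl => ∑ ij, (matR Λ f - 1) kl ij * (conjT T ij - T ij) with hDdef
  suffices h : D = 0 by
    rw [← sub_eq_zero, ← Finset.sum_sub_distrib]
    simpa only [hDdef, mul_sub, Pi.zero_apply] using congrFun h kl
  refine eq_zero_of_invariant hd h₂ (fun ij => conjT T ij - T ij) D (fun _ => rfl) fun kl => ?_
  have q := hd.quadratic kl
  -- The adjoint of the relation with swapped index pair is the same relation with conj Z and conj T
  -- in place of Z and T. In the difference the p-terms cancel, and what remains is the invariance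
  -- of D.
  have q' : ∑ ij : I × I, (matR Λ f - 1) kl ij •
      (p ij.1 * p ij.2 - ∑ s, conjZ (matZ Λ η) ij s • p s + algebraMap ℂ B (conjT T ij)
        - inc (∑ mn : I × I, conjT T mn • (Λ ij.1 mn.1 * Λ ij.2 mn.2))) = 0 := by
    have h := congrArg star (hd.quadratic kl.swap)
    rw [star_zero, star_sum] at h
    rw [← h]
    refine Fintype.sum_equiv (Equiv.prodComm I I) _ _ fun ij => ?_
    simp only [star_smul, star_sub, star_add, star_sum, star_mul, hst.star_p, ← hst.inc_star, hs,
      star_sub_one hR, ← algebraMap_star_comm, Equiv.prodComm_apply, Prod.swap_swap, Prod.fst_swap,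
      Prod.snd_swap, conjZ, conjT]
    congr 3
    exact Fintype.sum_equiv (Equiv.prodComm I I) _ _ fun mn => rfl
  apply hG.inc_injective
  have h := sub_eq_zero.2 (q'.trans q.symm)
  simp only [smul_sub, smul_add, Finset.sum_add_distrib, Finset.sum_sub_distrib,
    sum_sub_one_smul_conjZ hZ] at h
  -- R - 1 passes through Λ ⊗ Λ, so only (R - 1)S enters.
  have h₃ : ∀ S : I × I → ℂ, ∑ ij : I × I, (matR Λ f - 1) kl ij •
      inc (∑ mn : I × I, S mn • (Λ ij.1 mn.1 * Λ ij.2 mn.2)) =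
      inc (∑ mn : I × I, (∑ ij, (matR Λ f - 1) mn ij * S ij) • (Λ kl.1 mn.1 * Λ kl.2 mn.2)) := by
    intro S
    simp only [← map_smul, ← map_sum, Finset.smul_sum]
    rw [Finset.sum_comm]
    simp only [smul_comm _ (S _), ← Finset.smul_sum, hG.sub_one_intertwines hd hΛ hs]
    simp only [Finset.smul_sum, Finset.sum_smul, smul_smul, mul_comm (S _)]
    rw [Finset.sum_comm]
  simp only [h₃] at h
  simp only [hDdef, mul_sub, Finset.sum_sub_distrib, sub_mul, map_sub, map_sum, map_mul,
    Algebra.smul_def, AlgHomClass.commutes] at h ⊢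
  rw [← sub_eq_zero, ← h]
  abel

end Reality
-- The universal algebra: lifting, size and involution.
section Universal

variable {I : Type*} [Fintype I] [DecidableEq I] {R : Matrix (I × I) (I × I) ℂ}
  {Z : Matrix (I × I) I ℂ} {T : I × I → ℂ}

theorem lift_minkowskiRelator {D : Type*} [Ring D] [Algebra ℂ D] (x : I → D) (kl : I × I) :
    FreeAlgebra.lift ℂ x (minkowskiRelator R Z T kl) = relator R Z T x kl := by
  simp [minkowskiRelator, relator]

theorem sum_sub_one_smul_mem {D : Type*} [Ring D] [Algebra ℂ D] {x : I → D} {kl : I × I}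
    (h : relator R Z T x kl = 0) : ∑ ij : I × I, (R - 1) kl ij • (x ij.1 * x ij.2) ∈
      Submodule.span ℂ (insert 1 (Set.range x)) := by
  simp only [relator, smul_add, smul_sub, Finset.sum_add_distrib, Finset.sum_sub_distrib] at h
  rw [sub_add, sub_eq_zero] at h
  rw [h]
  refine sub_mem (Submodule.sum_mem _ fun ij _ => Submodule.smul_mem _ _
    (Submodule.sum_mem _ fun m _ => Submodule.smul_mem _ _ (Submodule.subset_span
      (Set.mem_insert_of_mem _ ⟨m, rfl⟩)))) (Submodule.sum_mem _ fun ij _ => Submodule.smul_mem _ _ ?_)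
  rw [Algebra.algebraMap_eq_smul_one]
  exact Submodule.smul_mem _ _ (Submodule.subset_span (Set.mem_insert _ _))

namespace MinkowskiAlgebra

theorem relator_x (kl : I × I) : relator R Z T (x R Z T) kl = 0 := by
  have h := RingQuot.mkAlgHom_rel ℂ (s := fun a b : FreeAlgebra ℂ I =>
    (∃ kl, a = minkowskiRelator R Z T kl) ∧ b = 0) ⟨⟨kl, rfl⟩, rfl⟩
  rw [map_zero] at h
  rw [← h, ← lift_minkowskiRelator]
  congr 1
  ext i
  simp [x]

/-- The algebra homomorphism given by elements that satisfy the relations. -/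
noncomputable def lift {D : Type*} [Ring D] [Algebra ℂ D] (y : I → D)
    (hy : ∀ kl, relator R Z T y kl = 0) : MinkowskiAlgebra R Z T →ₐ[ℂ] D :=
  RingQuot.liftAlgHom ℂ ⟨FreeAlgebra.lift ℂ y, by
    rintro _ _ ⟨⟨kl, rfl⟩, rfl⟩
    rw [lift_minkowskiRelator, hy, map_zero]⟩

@[simp]
theorem lift_x {D : Type*} [Ring D] [Algebra ℂ D] (y : I → D)
    (hy : ∀ kl, relator R Z T y kl = 0) (i : I) : lift y hy (x R Z T i) = y i := by
  simp [lift, x]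

theorem adjoin_range_x : Algebra.adjoin ℂ (Set.range (x R Z T)) = ⊤ := by
  have h : Set.range (x R Z T) = RingQuot.mkAlgHom ℂ _ '' Set.range (FreeAlgebra.ι ℂ) := by
    rw [← Set.range_comp]
    rfl
  rw [h, ← AlgHom.map_adjoin, FreeAlgebra.adjoin_range_ι, Algebra.map_top,
    AlgHom.range_eq_top]
  exact RingQuot.mkAlgHom_surjective ℂ _

/-- The index type may lie in any universe, but axiom 3 tests only against algebras in a fixed one.
Relabelling the generators by `Fin` presents the algebra as a quotient of a free algebra in `Type`.
-/
instance small : Small.{w} (MinkowskiAlgebra R Z T) := by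
  let e := (Fintype.equivFin I).symm
  refine small_of_surjective (f := FreeAlgebra.lift ℂ (x R Z T ∘ e)) ?_
  rw [← AlgHom.range_eq_top, ← Algebra.map_top, ← FreeAlgebra.adjoin_range_ι, AlgHom.map_adjoin,
    ← Set.range_comp, ← adjoin_range_x]
  congr 1
  rw [← e.surjective.range_comp (x R Z T)]
  congr 1
  ext i
  simp

end MinkowskiAlgebra

/-- The opposite of a complex algebra, with the conjugate action of the scalars. -/
def ConjOp (D : Type*) : Type _ := Dᵐᵒᵖ

namespace ConjOp

variable {D : Type*} [Ring D] [Algebra ℂ D]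

instance : Ring (ConjOp D) := inferInstanceAs (Ring Dᵐᵒᵖ)

/-- The identity as an additive map onto the opposite algebra. -/
def op : D ≃+ ConjOp D := MulOpposite.opAddEquiv

omit [Algebra ℂ D] in
theorem op_mul (a b : D) : op (a * b) = op b * op a := rfl

omit [Algebra ℂ D] in
theorem op_one : op (1 : D) = 1 := rfl

noncomputable instance : Algebra ℂ (ConjOp D) :=
  RingHom.toAlgebra' (((algebraMap ℂ D).toOpposite fun a _ => Algebra.commute_algebraMap_left a _
    ).comp (starRingEnd ℂ)) fun c a => by
      obtain ⟨a, rfl⟩ := op.surjective a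
      exact (congrArg op (Algebra.commutes (star c) a)).symm

theorem op_smul (c : ℂ) (a : D) : op (c • a) = star c • op a := by
  rw [Algebra.smul_def, Algebra.commutes, op_mul, Algebra.smul_def]
  change _ = op (algebraMap ℂ D (star (star c))) * op a
  rw [star_star]

theorem op_algebraMap (c : ℂ) : op (algebraMap ℂ D c) = algebraMap ℂ (ConjOp D) (star c) := by
  rw [Algebra.algebraMap_eq_smul_one, Algebra.algebraMap_eq_smul_one, op_smul, op_one]

end ConjOp

/-- Reversing products swaps the index pairs and conjugates the coefficients; the reality conditions
say precisely that this carries relators to relators. -/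
theorem relator_op {D : Type*} [Ring D] [Algebra ℂ D]
    (hR : ∀ ij st, star (R ij st) = R ij.swap st.swap)
    (hZ : (R - 1) * conjZ Z = (R - 1) * Z)
    (hT : ∀ kl, ∑ ij, (R - 1) kl ij * conjT T ij = ∑ ij, (R - 1) kl ij * T ij)
    (x : I → D) (kl : I × I) :
    relator R Z T (fun i => ConjOp.op (x i)) kl = ConjOp.op (relator R Z T x kl.swap) := by
  have h : ConjOp.op (relator R Z T x kl.swap) =
      relator R (conjZ Z) (conjT T) (fun i => ConjOp.op (x i)) kl := by
    simp only [relator, map_sum]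
    refine Fintype.sum_equiv (Equiv.prodComm I I) _ _ fun ij => ?_
    simp only [ConjOp.op_smul, map_add, map_sub, map_sum, ConjOp.op_mul, ConjOp.op_algebraMap,
      star_sub_one hR, Equiv.prodComm_apply, Prod.swap_swap, Prod.fst_swap, Prod.snd_swap, conjZ,
      conjT]
  rw [h]
  have hT' : ∑ ij, (R - 1) kl ij • algebraMap ℂ (ConjOp D) (conjT T ij) =
      ∑ ij, (R - 1) kl ij • algebraMap ℂ (ConjOp D) (T ij) := by
    simpa only [map_sum, map_mul, ← Algebra.smul_def] using
      congrArg (algebraMap ℂ (ConjOp D)) (hT kl)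
  simp only [relator, smul_add, smul_sub, Finset.sum_add_distrib, Finset.sum_sub_distrib,
    sum_sub_one_smul_conjZ hZ, hT']

/-- The `*`-structure of the universal algebra for which the generators are self-adjoint. -/
theorem MinkowskiAlgebra.exists_starRing
    (hR : ∀ ij st, star (R ij st) = R ij.swap st.swap)
    (hZ : (R - 1) * conjZ Z = (R - 1) * Z)
    (hT : ∀ kl, ∑ ij, (R - 1) kl ij * conjT T ij = ∑ ij, (R - 1) kl ij * T ij) :
    ∃ (_ : StarRing (MinkowskiAlgebra R Z T)) (_ : StarModule ℂ (MinkowskiAlgebra R Z T)),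
      ∀ i, star (x R Z T i) = x R Z T i := by
  -- A conjugate linear antihomomorphism is a linear homomorphism into `ConjOp`, so the universal
  -- property provides the involution.
  let σ : MinkowskiAlgebra R Z T →ₐ[ℂ] ConjOp (MinkowskiAlgebra R Z T) :=
    lift (fun i => ConjOp.op (x R Z T i)) fun kl => by
      rw [relator_op hR hZ hT, relator_x, map_zero]
  let s : MinkowskiAlgebra R Z T → MinkowskiAlgebra R Z T := fun a => ConjOp.op.symm (σ a)
  have op_s : ∀ a, ConjOp.op (s a) = σ a := fun a => ConjOp.op.apply_symm_apply _
  have s_x : ∀ i, s (x R Z T i) = x R Z T i := fun i => by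
    apply ConjOp.op.injective
    rw [op_s, lift_x]
  have s_add : ∀ a b, s (a + b) = s a + s b := fun a b => by simp [s]
  have s_mul : ∀ a b, s (a * b) = s b * s a := fun a b => by
    apply ConjOp.op.injective
    rw [op_s, map_mul, ConjOp.op_mul, op_s, op_s]
  have s_smul : ∀ (c : ℂ) a, s (c • a) = star c • s a := fun c a => by
    apply ConjOp.op.injective
    rw [op_s, map_smul, ConjOp.op_smul, op_s, star_star]
  have s_algebraMap : ∀ c : ℂ, s (algebraMap ℂ _ c) = algebraMap ℂ _ (star c) := fun c => by
    apply ConjOp.op.injective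
    rw [op_s, AlgHom.commutes, ConjOp.op_algebraMap, star_star]
  have s_s : ∀ a, s (s a) = a := fun a => by
    have ha : a ∈ Algebra.adjoin ℂ (Set.range (x R Z T)) := by
      rw [adjoin_range_x]
      exact Algebra.mem_top
    induction ha using Algebra.adjoin_induction with
    | mem a ha =>
      obtain ⟨i, rfl⟩ := ha
      rw [s_x, s_x]
    | algebraMap c => rw [s_algebraMap, s_algebraMap, star_star]
    | add a b _ _ ha hb => rw [s_add, s_add, ha, hb]
    | mul a b _ _ ha hb => rw [s_mul, s_mul, ha, hb]
  let _ : StarRing (MinkowskiAlgebra R Z T) :=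
    { star := s, star_involutive := s_s, star_mul := s_mul, star_add := s_add }
  exact ⟨inferInstance, ⟨s_smul⟩, s_x⟩

end Universal

/-! ### Identities for coactions, checked on generators. -/

section Coaction

variable {I A B : Type*} [Fintype I] [DecidableEq I] [Ring A] [HopfAlgebra ℂ A]
  [Ring B] [Bialgebra ℂ B] {Λ : Matrix I I A} {inc : A →ₐc[ℂ] B} {p : I → B}

theorem map_star_of_adjoin_eq_top {ι D E : Type*} [Ring D] [Algebra ℂ D] [StarRing D]
    [StarModule ℂ D] [Ring E] [Algebra ℂ E] [StarRing E] [StarModule ℂ E] {x : ι → D}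
    (hgen : Algebra.adjoin ℂ (Set.range x) = ⊤) (g : D →ₐ[ℂ] E)
    (hx : ∀ i, star (x i) = x i) (hg : ∀ i, star (g (x i)) = g (x i)) (a : D) :
    g (star a) = star (g a) := by
  have ha : a ∈ Algebra.adjoin ℂ (Set.range x) := hgen ▸ Algebra.mem_top
  induction ha using Algebra.adjoin_induction with
  | mem a ha =>
    obtain ⟨i, rfl⟩ := ha
    rw [hx, hg]
  | algebraMap c =>
    rw [← algebraMap_star_comm, AlgHom.commutes, AlgHom.commutes, algebraMap_star_comm]
  | add a b _ _ ha hb => rw [star_add, map_add, map_add, star_add, ha, hb]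
  | mul a b _ _ ha hb => rw [star_mul, map_mul, map_mul, star_mul, ha, hb]

omit [DecidableEq I] in
/-- An algebra homomorphism that respects the generators intertwines the coactions. -/
theorem lTensor_coaction {C D : Type*} [Ring C] [Algebra ℂ C] [Ring D] [Algebra ℂ D]
    {x : I → C} {y : I → D} (hgen : Algebra.adjoin ℂ (Set.range x) = ⊤)
    (Ψ : C →ₐ[ℂ] B ⊗[ℂ] C) (hΨ : ∀ i, Ψ (x i) = ∑ j, inc (Λ i j) ⊗ₜ[ℂ] x j + p i ⊗ₜ[ℂ] (1 : C))
    (Φ : D →ₐ[ℂ] B ⊗[ℂ] D) (hΦ : ∀ i, Φ (y i) = ∑ j, inc (Λ i j) ⊗ₜ[ℂ] y j + p i ⊗ₜ[ℂ] (1 : D))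
    (g : C →ₐ[ℂ] D) (hg : ∀ i, g (x i) = y i) (c : C) :
    g.toLinearMap.lTensor B (Ψ c) = Φ (g c) := by
  have h : (Algebra.TensorProduct.map (AlgHom.id ℂ B) g).comp Ψ = Φ.comp g := by
    refine AlgHom.ext_of_adjoin_eq_top hgen ?_
    rintro _ ⟨i, rfl⟩
    simp [hΨ, hΦ, hg]
  exact AlgHom.congr_fun h c

theorem counit_coaction (hG : IsInhomogeneous Λ inc p) (hΛ : IsRep Λ)
    {C : Type*} [Ring C] [Algebra ℂ C] {x : I → C} (hgen : Algebra.adjoin ℂ (Set.range x) = ⊤)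
    (Ψ : C →ₐ[ℂ] B ⊗[ℂ] C) (hΨ : ∀ i, Ψ (x i) = ∑ j, inc (Λ i j) ⊗ₜ[ℂ] x j + p i ⊗ₜ[ℂ] (1 : C))
    (c : C) :
    TensorProduct.lid ℂ C ((Coalgebra.counit (R := ℂ) (A := B)).rTensor C (Ψ c)) = c := by
  have h : ((Algebra.TensorProduct.lid ℂ C).toAlgHom.comp (Algebra.TensorProduct.map
      (Bialgebra.counitAlgHom ℂ B) (AlgHom.id ℂ C))).comp Ψ = AlgHom.id ℂ C := by
    refine AlgHom.ext_of_adjoin_eq_top hgen ?_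
    rintro _ ⟨i, rfl⟩
    simp [hΨ, hG.counit_p, hΛ.counit]
  exact AlgHom.congr_fun h c

theorem coassoc_coaction (hG : IsInhomogeneous Λ inc p) (hΛ : IsRep Λ)
    {C : Type*} [Ring C] [Algebra ℂ C] {x : I → C} (hgen : Algebra.adjoin ℂ (Set.range x) = ⊤)
    (Ψ : C →ₐ[ℂ] B ⊗[ℂ] C) (hΨ : ∀ i, Ψ (x i) = ∑ j, inc (Λ i j) ⊗ₜ[ℂ] x j + p i ⊗ₜ[ℂ] (1 : C))
    (c : C) : Ψ.toLinearMap.lTensor B (Ψ c) =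
      TensorProduct.assoc ℂ B B C ((Coalgebra.comul (R := ℂ) (A := B)).rTensor C (Ψ c)) := by
  have h : (Algebra.TensorProduct.map (AlgHom.id ℂ B) Ψ).comp Ψ =
      ((Algebra.TensorProduct.assoc ℂ ℂ ℂ B B C).toAlgHom.comp (Algebra.TensorProduct.map
      (Bialgebra.comulAlgHom ℂ B) (AlgHom.id ℂ C))).comp Ψ := by
    refine AlgHom.ext_of_adjoin_eq_top hgen ?_
    rintro _ ⟨i, rfl⟩
    simp [hΨ, hG.comul_p, hΛ.comul_inc, TensorProduct.tmul_add, TensorProduct.add_tmul,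
      TensorProduct.tmul_sum, TensorProduct.sum_tmul, Finset.sum_add_distrib,
      Algebra.TensorProduct.one_def]
    rw [add_assoc, Finset.sum_comm]
  exact AlgHom.congr_fun h c

end Coaction
-- Axioms 1 and 2 against the quadratic relations.
section Minkowski

variable {I A B : Type*} [Fintype I] [DecidableEq I] [Ring A] [HopfAlgebra ℂ A]
  [StarRing A] [StarModule ℂ A] [Ring B] [Bialgebra ℂ B] [StarRing B] [StarModule ℂ B]
  {Λ : Matrix I I A} {inc : A →ₐc[ℂ] B} {p : I → B}
  {f : I → I → A →ₗ[ℂ] ℂ} {η : I → A →ₗ[ℂ] ℂ} {T : I × I → ℂ}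

/-- An algebra generated by self-adjoint elements with the quadratic relations, on which `Ψ` coacts
by inhomogeneous transformations, satisfies axioms 1 and 2. -/
theorem isMinkowskiPre_of_relations (hH : IsHomogeneousPart Λ) (hG : IsInhomogeneous Λ inc p)
    (hd : IsDescribedBy Λ inc p f η T) {C : Type*} [Ring C] [Algebra ℂ C] [StarRing C]
    [StarModule ℂ C] {x : I → C} (hgen : Algebra.adjoin ℂ (Set.range x) = ⊤)
    (hx : ∀ kl, relator (matR Λ f) (matZ Λ η) T x kl = 0)
    (hstar : ∀ i, star (x i) = x i) (Ψ : C →⋆ₐ[ℂ] B ⊗[ℂ] C)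
    (hΨ : ∀ i, Ψ (x i) = ∑ j, inc (Λ i j) ⊗ₜ[ℂ] x j + p i ⊗ₜ[ℂ] (1 : C)) :
    IsMinkowskiPre Λ inc p Ψ x where
  generated := hgen
  counit := counit_coaction hG hH.irreducible.isRep hgen Ψ.toAlgHom hΨ
  coassoc := coassoc_coaction hG hH.irreducible.isRep hgen Ψ.toAlgHom hΨ
  star_x := hstar
  coaction := hΨ
  eq_scalar := fun W hW y hy => by
    refine mem_span_one_of_coaction_mem Ψ.toAlgHom hΨ hG hd hH.irreducible hH.star_Λ
      (fun kl => sum_sub_one_smul_mem (hx kl)) hgen ?_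
    obtain ⟨t, ht⟩ := hW y hy
    change Ψ y ∈ _
    rw [← ht]
    clear ht
    induction t with
    | zero => simp
    | add s t hs ht => rw [map_add]; exact add_mem hs ht
    | tmul a b => exact tmul_mem_tens (inc_mem_incRange inc a) Submodule.mem_top

/-- Relations and generators pass through an isomorphism, so axiom 2 need not be transported. It
serves a copy of the universal algebra in another universe and the converse half of the
classification. -/
theorem isMinkowskiPre_of_starAlgEquiv (hH : IsHomogeneousPart Λ)
    (hG : IsInhomogeneous Λ inc p) (hd : IsDescribedBy Λ inc p f η T) {C D : Type*}
    [Ring C] [Algebra ℂ C] [StarRing C] [StarModule ℂ C]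
    [Ring D] [Algebra ℂ D] [StarRing D] [StarModule ℂ D] {x : I → C}
    (hgen : Algebra.adjoin ℂ (Set.range x) = ⊤)
    (hx : ∀ kl, relator (matR Λ f) (matZ Λ η) T x kl = 0) (hstar : ∀ i, star (x i) = x i)
    (e : C ≃⋆ₐ[ℂ] D) (Ψ : D →⋆ₐ[ℂ] B ⊗[ℂ] D)
    (hΨ : ∀ i, Ψ (e (x i)) = ∑ j, inc (Λ i j) ⊗ₜ[ℂ] e (x j) + p i ⊗ₜ[ℂ] (1 : D)) :
    IsMinkowskiPre Λ inc p Ψ (e ∘ x) := by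
  refine isMinkowskiPre_of_relations hH hG hd ?_ (fun kl => ?_) (fun i => ?_) Ψ hΨ
  · have h := AlgHom.map_adjoin (e : C →⋆ₐ[ℂ] D).toAlgHom (Set.range x)
    rw [hgen, Algebra.map_top, (AlgHom.range_eq_top _).2 e.surjective, ← Set.range_comp] at h
    exact h.symm
  · have h := map_relator (e : C →⋆ₐ[ℂ] D).toAlgHom (matR Λ f) (matZ Λ η) T x kl
    rw [hx, map_zero] at h
    exact h.symm
  · rw [Function.comp_apply, ← map_star, hstar]

/-- Axioms 1 and 2 imply the quadratic relations. -/
theorem IsMinkowskiPre.relator_eq_zero (hH : IsHomogeneousPart Λ) (hG : IsInhomogeneous Λ inc p)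
    (hd : IsDescribedBy Λ inc p f η T)
    (h₂ : ∀ M : Matrix (I × I) Unit ℂ, IsMor (trivialRep A) (Λ ⊗ₖ Λ) M →
      (matR Λ f + 1) * M = 0 → M = 0)
    {C : Type*} [Ring C] [Algebra ℂ C] [StarRing C] [StarModule ℂ C]
    {Ψ : C →⋆ₐ[ℂ] B ⊗[ℂ] C} {x : I → C} (h : IsMinkowskiPre Λ inc p Ψ x) (kl : I × I) :
    relator (matR Λ f) (matZ Λ η) T x kl = 0 := by
  nontriviality C
  obtain ⟨g, hg⟩ := Module.Projective.exists_dual_eq_one ℂ (one_ne_zero (α := C))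
  set w := relator (matR Λ f) (matZ Λ η) T x with hw
  have hΨ : ∀ kl, Ψ (w kl) = ∑ mn : I × I, inc (Λ kl.1 mn.1 * Λ kl.2 mn.2) ⊗ₜ[ℂ] w mn := by
    intro kl
    rw [← hG.relator_coaction hd hH.irreducible hH.star_Λ]
    refine (map_relator Ψ.toAlgHom _ _ _ x kl).trans ?_
    congr 1
    exact funext h.coaction
  -- Axiom 2 applied to the span of the relators, which coacts with coefficients Λ_km Λ_ln in A.
  have hmem : ∀ kl, w kl ∈ Submodule.span ℂ {(1 : C)} := by
    intro kl
    refine h.eq_scalar (Submodule.span ℂ (Set.range w)) (fun y hy => ?_)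
      (Submodule.subset_span ⟨kl, rfl⟩)
    induction hy using Submodule.span_induction with
    | mem y hy =>
      obtain ⟨kl, rfl⟩ := hy
      rw [hΨ]
      exact Submodule.sum_mem _ fun mn _ => ⟨(Λ kl.1 mn.1 * Λ kl.2 mn.2) ⊗ₜ
        ⟨w mn, Submodule.subset_span ⟨mn, rfl⟩⟩, rfl⟩
    | zero => rw [map_zero]; exact zero_mem _
    | add a b _ _ ha hb => rw [map_add]; exact add_mem ha hb
    | smul r a _ ha => rw [map_smul]; exact Submodule.smul_mem _ r ha
  have hwg : ∀ kl, w kl = g (w kl) • (1 : C) := fun kl => by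
    obtain ⟨r, hr⟩ := Submodule.mem_span_singleton.1 (hmem kl)
    rw [← hr, map_smul, hg, smul_eq_mul, mul_one]
  -- The scalars g(w) form a vector in the image of R - 1, and g on the right leg of the
  -- transformation law shows that it is invariant under Λ ⊗ Λ.
  have hD : (fun kl => g (w kl)) = 0 := by
    refine eq_zero_of_invariant hd h₂ (fun ij => g (x ij.1 * x ij.2 - ∑ m, matZ Λ η ij m • x m +
      algebraMap ℂ C (T ij))) _ (fun kl => ?_) fun kl => ?_
    · simp only [hw, relator, map_sum g, map_smul g, smul_eq_mul]
    · apply hG.inc_injective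
      have h := congrArg (sliceRight g) (hΨ kl)
      rw [hwg kl, map_smul, map_one, map_smul, Algebra.TensorProduct.one_def] at h
      simp only [map_sum, sliceRight_tmul, hg, one_smul] at h
      simpa only [map_sum, map_smul, map_one, Algebra.algebraMap_eq_smul_one] using h
  rw [hwg, congrFun hD kl, Pi.zero_apply, zero_smul]

/-- The universal algebra is universal among the algebras that satisfy axioms 1 and 2. -/
theorem MinkowskiAlgebra.exists_starAlgHom (hH : IsHomogeneousPart Λ)
    (hG : IsInhomogeneous Λ inc p) (hd : IsDescribedBy Λ inc p f η T)
    (h₂ : ∀ M : Matrix (I × I) Unit ℂ, IsMor (trivialRep A) (Λ ⊗ₖ Λ) M →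
      (matR Λ f + 1) * M = 0 → M = 0)
    [StarRing (MinkowskiAlgebra (matR Λ f) (matZ Λ η) T)]
    [StarModule ℂ (MinkowskiAlgebra (matR Λ f) (matZ Λ η) T)]
    (hstar : ∀ i, star (x (matR Λ f) (matZ Λ η) T i) = x (matR Λ f) (matZ Λ η) T i)
    {C : Type*} [Ring C] [Algebra ℂ C] [StarRing C] [StarModule ℂ C]
    {Ψ : C →⋆ₐ[ℂ] B ⊗[ℂ] C} {y : I → C} (h : IsMinkowskiPre Λ inc p Ψ y) :
    ∃ ρ : MinkowskiAlgebra (matR Λ f) (matZ Λ η) T →⋆ₐ[ℂ] C,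
      ∀ i, ρ (x (matR Λ f) (matZ Λ η) T i) = y i :=
  ⟨{ lift y (h.relator_eq_zero hH hG hd h₂) with
      map_star' := map_star_of_adjoin_eq_top adjoin_range_x
        (lift y (h.relator_eq_zero hH hG hd h₂)) hstar fun i => by rw [lift_x, h.star_x] },
    lift_x y (h.relator_eq_zero hH hG hd h₂)⟩

/-- A small `*`-algebra has a model in the given universe. -/
theorem exists_starAlgEquiv_of_small (D : Type*) [Ring D] [Algebra ℂ D] [StarRing D]
    [StarModule ℂ D] [Small.{w} D] :
    ∃ (C : Type w) (_ : Ring C) (_ : Algebra ℂ C) (_ : StarRing C) (_ : StarModule ℂ C),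
      Nonempty (D ≃⋆ₐ[ℂ] C) := by
  let e : Shrink.{w} D ≃ₐ[ℂ] D := Shrink.algEquiv ℂ D
  let _ : StarRing (Shrink.{w} D) :=
    { star := fun a => e.symm (star (e a))
      star_involutive := fun a => by simp
      star_mul := fun a b => by simp
      star_add := fun a b => by simp }
  have star_def : ∀ a : Shrink.{w} D, star a = e.symm (star (e a)) := fun _ => rfl
  refine ⟨Shrink.{w} D, inferInstance, inferInstance, inferInstance,
    ⟨fun c a => by simp [star_def]⟩, ⟨StarAlgEquiv.ofBijective
      ({ e.symm.toAlgHom with map_star' := fun a => ?_ } : D →⋆ₐ[ℂ] Shrink.{w} D)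
      e.symm.bijective⟩⟩
  change e.symm (star a) = star (e.symm a)
  rw [star_def, e.apply_symm_apply]

end Minkowski
end InhomQG

open InhomQG

theorem theorem5p6 {I : Type*} [Fintype I] [DecidableEq I]
    -- the Hopf `*`-algebra `A = Poly(H)` with the representation `Λ`
    {A : Type*} [Ring A] [HopfAlgebra ℂ A] [StarRing A] [StarModule ℂ A]
    (Λ : Matrix I I A) (hH : IsHomogeneousPart Λ)
    -- the `*`-bialgebra `B = Poly(G)`, described by `p`, `f`, `η`, `T`
    {B : Type*} [Ring B] [Bialgebra ℂ B] [StarRing B] [StarModule ℂ B]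
    (inc : A →ₐc[ℂ] B) (p : I → B)
    (f : I → I → A →ₗ[ℂ] ℂ) (η : I → A →ₗ[ℂ] ℂ) (T : I × I → ℂ)
    (hG : IsInhomogeneous Λ inc p) (hd : IsDescribedBy Λ inc p f η T)
    (hs : IsStarCompatible inc p)
    -- `Mor(I, Λ ⊗ Λ) ∩ ker (R + 1) = 0`
    (h₂ : ∀ M : Matrix (I × I) Unit ℂ, IsMor (trivialRep A) (Λ ⊗ₖ Λ) M →
      (matR Λ f + 1) * M = 0 → M = 0)
    -- `Mor(I, Λ ⊗ Λ ⊗ Λ) = 0`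
    (h₃ : ∀ M : Matrix (I × I × I) Unit ℂ, IsMor (trivialRep A) (Λ ⊗ₖ (Λ ⊗ₖ Λ)) M → M = 0) :
    -- the universal algebra carries the `*`-structure and the coaction of the statement,
    ∃ (_ : StarRing (MinkowskiAlgebra (matR Λ f) (matZ Λ η) T))
      (_ : StarModule ℂ (MinkowskiAlgebra (matR Λ f) (matZ Λ η) T))
      (Ψ₀ : MinkowskiAlgebra (matR Λ f) (matZ Λ η) T →⋆ₐ[ℂ]
        B ⊗[ℂ] MinkowskiAlgebra (matR Λ f) (matZ Λ η) T),
      (∀ i, star (MinkowskiAlgebra.x (matR Λ f) (matZ Λ η) T i) =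
        MinkowskiAlgebra.x (matR Λ f) (matZ Λ η) T i) ∧
      (∀ i, Ψ₀ (MinkowskiAlgebra.x (matR Λ f) (matZ Λ η) T i) =
        ∑ j, inc (Λ i j) ⊗ₜ[ℂ] MinkowskiAlgebra.x (matR Λ f) (matZ Λ η) T j
          + p i ⊗ₜ[ℂ] (1 : MinkowskiAlgebra (matR Λ f) (matZ Λ η) T)) ∧
      -- it is an analogue of Minkowski space,
      IsMinkowski Λ inc p Ψ₀ ∧
      -- and the analogues of Minkowski space are exactly the pairs `*`-isomorphic to it
      ∀ (C : Type w) [Ring C] [Algebra ℂ C] [StarRing C] [StarModule ℂ C]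
        (Ψ : C →⋆ₐ[ℂ] B ⊗[ℂ] C),
        IsMinkowski Λ inc p Ψ ↔
          ∃ e : C ≃⋆ₐ[ℂ] MinkowskiAlgebra (matR Λ f) (matZ Λ η) T,
            ∀ c, (e : C →⋆ₐ[ℂ] MinkowskiAlgebra (matR Λ f) (matZ Λ η) T).toAlgHom.toLinearMap.lTensor
              B (Ψ c) = Ψ₀ (e c) := by
  have hΛ := hH.irreducible
  have hsΛ := hH.star_Λ
  obtain ⟨_, _, hstar⟩ := MinkowskiAlgebra.exists_starRing (hs.star_matR hG hd hΛ hsΛ)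
    (hs.sub_one_mul_conjZ hH hG hd) (hs.sub_one_mul_conjT hH hG hd h₂)
  set C₀ := MinkowskiAlgebra (matR Λ f) (matZ Λ η) T
  set x₀ : I → C₀ := MinkowskiAlgebra.x (matR Λ f) (matZ Λ η) T
  have hgen : Algebra.adjoin ℂ (Set.range x₀) = ⊤ := MinkowskiAlgebra.adjoin_range_x
  let ψ : C₀ →ₐ[ℂ] B ⊗[ℂ] C₀ := MinkowskiAlgebra.lift
    (fun i => ∑ j, inc (Λ i j) ⊗ₜ[ℂ] x₀ j + p i ⊗ₜ[ℂ] (1 : C₀)) fun kl => by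
      rw [hG.relator_coaction hd hΛ hsΛ]
      exact Finset.sum_eq_zero fun mn _ => (congrArg _ (MinkowskiAlgebra.relator_x mn)).trans
        (TensorProduct.tmul_zero _ _)
  have hψ : ∀ i, ψ (x₀ i) = ∑ j, inc (Λ i j) ⊗ₜ[ℂ] x₀ j + p i ⊗ₜ[ℂ] (1 : C₀) :=
    MinkowskiAlgebra.lift_x _ _
  let Ψ₀ : C₀ →⋆ₐ[ℂ] B ⊗[ℂ] C₀ :=
    { ψ with
      map_star' := map_star_of_adjoin_eq_top hgen ψ hstar fun i => by
        simp only [hψ, star_add, star_sum, TensorProduct.star_tmul, ← hs.inc_star, hsΛ, hs.star_p,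
          hstar, star_one] }
  have hΨ₀ : ∀ i, Ψ₀ (x₀ i) = ∑ j, inc (Λ i j) ⊗ₜ[ℂ] x₀ j + p i ⊗ₜ[ℂ] (1 : C₀) := hψ
  refine ⟨inferInstance, inferInstance, Ψ₀, hstar, hΨ₀, ⟨x₀, ?_, ?_⟩, ?_⟩
  · exact isMinkowskiPre_of_relations hH hG hd hgen MinkowskiAlgebra.relator_x hstar _ hΨ₀
  · intro C' _ _ _ _ Ψ' x' h'
    obtain ⟨ρ, hρ⟩ := MinkowskiAlgebra.exists_starAlgHom hH hG hd h₂ hstar h'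
    exact ⟨ρ, hρ, lTensor_coaction hgen Ψ₀.toAlgHom hΨ₀ Ψ'.toAlgHom h'.coaction ρ.toAlgHom hρ⟩
  · intro C _ _ _ _ Ψ
    constructor
    · rintro ⟨x, hx, hxuniv⟩
      -- Axiom 3 for C only reaches algebras in the universe of C, so it is applied to a copy C₁ of
      -- C₀ there.
      obtain ⟨C₁, _, _, _, _, ⟨e₁⟩⟩ := exists_starAlgEquiv_of_small.{w} C₀
      let ψ₁ : C₁ →ₐ[ℂ] B ⊗[ℂ] C₁ := (Algebra.TensorProduct.map (AlgHom.id ℂ B)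
        (e₁ : C₀ →⋆ₐ[ℂ] C₁).toAlgHom).comp (ψ.comp (e₁.symm : C₁ →⋆ₐ[ℂ] C₀).toAlgHom)
      have hψ₁ : ∀ i, ψ₁ (e₁ (x₀ i)) =
          ∑ j, inc (Λ i j) ⊗ₜ[ℂ] e₁ (x₀ j) + p i ⊗ₜ[ℂ] (1 : C₁) := fun i => by
        simp [ψ₁, hψ]
      let Ψ₁ : C₁ →⋆ₐ[ℂ] B ⊗[ℂ] C₁ :=
        { ψ₁ with
          map_star' := fun a => by
            obtain ⟨c, rfl⟩ := e₁.surjective a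
            change ψ₁ (star (e₁ c)) = star (ψ₁ (e₁ c))
            rw [← map_star]
            refine map_star_of_adjoin_eq_top hgen (ψ₁.comp (e₁ : C₀ →⋆ₐ[ℂ] C₁).toAlgHom) hstar
              (fun i => ?_) c
            change star (ψ₁ (e₁ (x₀ i))) = ψ₁ (e₁ (x₀ i))
            simp only [hψ₁, star_add, star_sum, TensorProduct.star_tmul, ← hs.inc_star, hsΛ,
              hs.star_p, ← map_star e₁, hstar, star_one] }
      obtain ⟨ρ, hρ, -⟩ := hxuniv C₁ Ψ₁ (e₁ ∘ x₀) (isMinkowskiPre_of_starAlgEquiv hH hG hd hgen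
        MinkowskiAlgebra.relator_x hstar e₁ Ψ₁ hψ₁)
      obtain ⟨σ, hσ⟩ := MinkowskiAlgebra.exists_starAlgHom hH hG hd h₂ hstar hx
      -- The maps τ and σ are mutually inverse because both respect the generators.
      let τ : C →⋆ₐ[ℂ] C₀ := (e₁.symm : C₁ →⋆ₐ[ℂ] C₀).comp ρ
      have hτ : ∀ i, τ (x i) = x₀ i := fun i => by
        simp [τ, hρ]
      have h₁ : ∀ a, σ (τ a) = a := AlgHom.congr_fun (φ₁ := σ.toAlgHom.comp τ.toAlgHom)
        (φ₂ := AlgHom.id ℂ C) (AlgHom.ext_of_adjoin_eq_top hx.generated (by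
          rintro _ ⟨i, rfl⟩
          exact (congrArg σ (hτ i)).trans (hσ i)))
      have h₂ : ∀ a, τ (σ a) = a := AlgHom.congr_fun (φ₁ := τ.toAlgHom.comp σ.toAlgHom)
        (φ₂ := AlgHom.id ℂ C₀) (AlgHom.ext_of_adjoin_eq_top hgen (by
          rintro _ ⟨i, rfl⟩
          exact (congrArg τ (hσ i)).trans (hτ i)))
      exact ⟨StarAlgEquiv.ofStarAlgHom τ σ (StarAlgHom.ext h₁) (StarAlgHom.ext h₂),
        lTensor_coaction hx.generated Ψ.toAlgHom hx.coaction Ψ₀.toAlgHom hΨ₀ τ.toAlgHom hτ⟩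
    · rintro ⟨e, he⟩
      have hΨ : ∀ i, Ψ (e.symm (x₀ i)) =
          ∑ j, inc (Λ i j) ⊗ₜ[ℂ] e.symm (x₀ j) + p i ⊗ₜ[ℂ] (1 : C) := fun i => by
        -- Over ℂ the map id ⊗ e is injective, so the formula for Ψ may be checked after applying
        -- it, where it becomes the one for Ψ₀.
        apply (Module.Flat.lTensor_preserves_injective_linearMap (M := B)
          (e : C →⋆ₐ[ℂ] C₀).toAlgHom.toLinearMap e.injective)
        rw [he, e.apply_symm_apply, hΨ₀]
        simp
      have hpre := isMinkowskiPre_of_starAlgEquiv hH hG hd hgen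
        MinkowskiAlgebra.relator_x hstar e.symm Ψ hΨ
      refine ⟨_, hpre, ?_⟩
      intro C' _ _ _ _ Ψ' x' h'
      obtain ⟨ρ, hρ⟩ := MinkowskiAlgebra.exists_starAlgHom hH hG hd h₂ hstar h'
      have hρe : ∀ i, ρ.comp (e : C →⋆ₐ[ℂ] C₀) (e.symm (x₀ i)) = x' i := fun i =>
        (congrArg ρ (e.apply_symm_apply _)).trans (hρ i)
      exact ⟨ρ.comp (e : C →⋆ₐ[ℂ] C₀), hρe, lTensor_coaction hpre.generated Ψ.toAlgHom
        hpre.coaction Ψ'.toAlgHom h'.coaction (ρ.comp (e : C →⋆ₐ[ℂ] C₀)).toAlgHom hρe⟩
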